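/- A graph here is finite and may have multiple edges, loops (adding 2 to the degree of their vertex) and semi-edges (edges with a single end, adding 1 to the degree); it is simple if it has no loops, no semi-edges and no multiple normal edges. A covering projection from a graph $G$ to a connected graph $H$ consists of surjections $V(G)\to V(H)$ and $E(G)\to E(H)$ that preserve degrees and incidences, map semi-edges to semi-edges and loops to loops, and are locally bijective on half-edges: the preimage of a normal edge $uv$ is a perfect matching between the preimages of $u$ and $v$, the preimage of a loop at $u$ is a disjoint union of cycles (a loop being a cycle of length 1, two parallel edges a cycle of length 2) spanning the preimage of $u$, and the preimage of a semi-edge at $u$ is a disjoint union of semi-edges and normal edges spanning the preimage of $u$. Write $G\longrightarrow H$ if such a projection exists, and $A\triangleright B$ ("$A$ is stronger than $B$") if every simple graph that covers $A$ also covers $B$. Let $F(a,b)$ be the one-vertex graph with $a$ semi-edges and $b$ loops, and $W(k,m,\ell,p,q)$ the two-vertex graph with $k$ semi-edges and $m$ loops at one vertex, $p$ loops and $q$ semi-edges at the other, and $\ell$ normal edges between them. Let $SG$ be the path on four vertices with its middle edge doubled and a loop at each end vertex, $DG$ the 4-cycle with two opposite edges doubled, $WG$ the triangle with one edge doubled whose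 third vertex is joined to a further vertex carrying a loop, and $LC$ the star $K_{1,3}$ with a loop at each leaf. **Theorem.** (i) Up to isomorphism, the connected cubic graphs that have one or two vertices, or have four vertices and no semi-edges, are exactly the following twelve pairwise non-isomorphic graphs: $$F(3,0),\ F(1,1),\ W(0,0,3,0,0),\ W(0,1,1,1,0),\ W(1,0,2,0,1),\ W(0,1,1,0,2),\ W(2,0,1,0,2),\ K_4,\ SG,\ DG,\ WG,\ LC.$$ (ii) On these twelve graphs (up to isomorphism) both $\longrightarrow$ and $\triangleright$ are partial orders. The relation $\longrightarrow$ is the reflexive and transitive closure of the following (green) arrows, which form its Hasse diagram: from $K_4$ to $W(1,0,2,0,1)$; from $SG$ to $W(0,1,1,1,0)$ and $W(0,1,1,0,2)$; from $DG$ to each of the five two-vertex graphs; from $WG$ to $F(1,1)$; from $W(0,0,3,0,0)$ to $F(3,0)$ and $F(1,1)$; from $W(0,1,1,1,0)$ to $F(1,1)$; from $W(1,0,2,0,1)$ to $F(3,0)$ and $F(1,1)$; from $W(2,0,1,0,2)$ to $F(3,0)$. (iii) The relation $\triangleright$ on these twelve graphs is the reflexive and transitive closure of the green arrows together with the three (purple)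 arrows from $W(2,0,1,0,2)$ to $W(0,1,1,0,2)$, from $W(0,1,1,0,2)$ to $W(0,1,1,1,0)$, and from $F(3,0)$ to $F(1,1)$. The purple arrows are exactly the arrows $A\to B$ of the Hasse diagram of $\triangleright$ for which $A\not\longrightarrow B$. (iv) If $A$ is a connected cubic graph without semi-edges on at most four vertices, then for every graph $B$, $A\triangleright B$ if and only if $A\longrightarrow B$. -/

import Mathlib

/-- A finite graph in which loops, semi-edges and multiple edges are allowed. A normal edge has two
distinct ends; a loop and a semi-edge at `v` both have `ends = s(v, v)`, and are told apart by
`isSemi`. (The types of vertices and edges are finite, so nothing is lost by taking them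
in `Type`.) -/
structure SGraph where
  V : Type
  E : Type
  [fintypeV : Fintype V]
  [fintypeE : Fintype E]
  [decEqV : DecidableEq V]
  [decEqE : DecidableEq E]
  ends : E → Sym2 V
  isSemi : E → Bool
  isDiag_of_isSemi : ∀ e, isSemi e = true → (ends e).IsDiag

namespace SGraph

attribute [instance] SGraph.fintypeV SGraph.fintypeE SGraph.decEqV SGraph.decEqE

/-- `e` is a semi-edge. -/
abbrev IsSemi (G : SGraph) (e : G.E) : Prop := G.isSemi e = true

/-- `e` is a loop. -/
abbrev IsLoop (G : SGraph) (e : G.E) : Prop := (G.ends e).IsDiag ∧ ¬ G.IsSemi e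

/-- The amount that the edge `e` adds to the degree of the vertex `v`. -/
def mult (G : SGraph) (v : G.V) (e : G.E) : ℕ :=
  if v ∈ G.ends e then (if G.IsLoop e then 2 else 1) else 0

/-- The degree of a vertex: normal edges and semi-edges count once, loops count twice. -/
def degree (G : SGraph) (v : G.V) : ℕ := ∑ e, G.mult v e

/-- Every vertex has degree 3. -/
def IsCubic (G : SGraph) : Prop := ∀ v, G.degree v = 3

/-- The graph has no semi-edges. -/
def SemiEdgeFree (G : SGraph) : Prop := ∀ e, ¬ G.IsSemi e

/-- No loops, no semi-edges and no multiple normal edges. -/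
def IsSimple (G : SGraph) : Prop :=
  (∀ e, ¬ G.IsLoop e) ∧ (∀ e, ¬ G.IsSemi e) ∧ Function.Injective G.ends

/-- Connectedness (in particular, there is at least one vertex). -/
def Connected (G : SGraph) : Prop := (SimpleGraph.fromEdgeSet (Set.range G.ends)).Connected

/-- Covering projections. In `local_bij`, the preimage of an edge `f` has at each vertex over an
end of `f` the same degree as `f` has at its end. Thus over an end of a normal edge or of a
semi-edge there is exactly one preimage edge, and over the vertex of a loop there is either one
loop or two normal edges in the preimage: the preimage of a loop is a spanning disjoint union of
cycles, as it is for the bijection between the half-edges at `v` and those at `onV v`. -/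
structure CoveringProjection (G H : SGraph) where
  onV : G.V → H.V
  onE : G.E → H.E
  surjective_onV : Function.Surjective onV
  surjective_onE : Function.Surjective onE
  degree_onV : ∀ v, H.degree (onV v) = G.degree v
  isSemi_onE : ∀ e, G.IsSemi e → H.IsSemi (onE e)
  isLoop_onE : ∀ e, G.IsLoop e → H.IsLoop (onE e)
  ends_onE : ∀ e, H.ends (onE e) = (G.ends e).map onV
  local_bij : ∀ (v : G.V) (f : H.E), onV v ∈ H.ends f →
    ∑ e with onE e = f, G.mult v e = H.mult (onV v) f

/-- `G ⟶ H`: there is a covering projection from `G` to the connected graph `H`. -/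
def Covers (G H : SGraph) : Prop := H.Connected ∧ Nonempty (CoveringProjection G H)

/-- `A ▷ B`: every simple graph that covers `A` also covers `B`. -/
def Stronger (A B : SGraph) : Prop := ∀ G : SGraph, G.IsSimple → G.Covers A → G.Covers B

/-- Isomorphisms of graphs. -/
structure Iso (G H : SGraph) where
  onV : G.V ≃ H.V
  onE : G.E ≃ H.E
  ends_onE : ∀ e, H.ends (onE e) = (G.ends e).map onV
  isSemi_onE : ∀ e, H.isSemi (onE e) = G.isSemi e

/-- `F(a,b)`: one vertex with `a` semi-edges and `b` loops. -/
def F (a b : ℕ) : SGraph where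
  V := Fin 1
  E := Fin a ⊕ Fin b
  ends := fun _ => s(0, 0)
  isSemi := Sum.elim (fun _ => true) (fun _ => false)
  isDiag_of_isSemi := fun _ _ => rfl

/-- `W(k,m,ℓ,p,q)`: two vertices, the first one with `k` semi-edges and `m` loops, the second one
with `p` loops and `q` semi-edges, and `ℓ` normal edges between them. -/
def W (k m l p q : ℕ) : SGraph where
  V := Fin 2
  E := (Fin k ⊕ Fin m) ⊕ Fin l ⊕ (Fin p ⊕ Fin q)
  ends := Sum.elim (fun _ => s(0, 0)) (Sum.elim (fun _ => s(0, 1)) (fun _ => s(1, 1)))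
  isSemi := Sum.elim (Sum.elim (fun _ => true) (fun _ => false))
    (Sum.elim (fun _ => false) (Sum.elim (fun _ => false) (fun _ => true)))
  isDiag_of_isSemi := by rintro ((e | e) | e | e | e) <;> simp

/-- The graph on `Fin n` without semi-edges whose edges have the listed ends. -/
def ofEnds {n m : ℕ} (ends : Fin m → Sym2 (Fin n)) : SGraph where
  V := Fin n
  E := Fin m
  ends := ends
  isSemi := fun _ => false
  isDiag_of_isSemi := by simp

/-- The complete graph on four vertices. -/
def K4 : SGraph := ofEnds (n := 4) ![s(0, 1), s(0, 2), s(0, 3), s(1, 2), s(1, 3), s(2, 3)]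

/-- The sausage graph: a path on four vertices with its middle edge doubled and a loop at each
end vertex. -/
def SG : SGraph := ofEnds (n := 4) ![s(0, 0), s(0, 1), s(1, 2), s(1, 2), s(2, 3), s(3, 3)]

/-- The drum graph: a 4-cycle with two opposite edges doubled. -/
def DG : SGraph := ofEnds (n := 4) ![s(0, 1), s(0, 1), s(1, 2), s(2, 3), s(2, 3), s(3, 0)]

/-- The wine glass graph: a triangle with one doubled edge, whose remaining vertex is joined to a
vertex with a loop. -/
def WG : SGraph := ofEnds (n := 4) ![s(0, 0), s(0, 1), s(1, 2), s(1, 3), s(2, 3), s(2, 3)]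

/-- The loopy claw: the star with three leaves and a loop at each leaf. -/
def LC : SGraph := ofEnds (n := 4) ![s(0, 1), s(0, 2), s(0, 3), s(1, 1), s(2, 2), s(3, 3)]

/-- The graphs under consideration: connected cubic graphs that have one or two vertices, or have
four vertices and no semi-edges. -/
def IsSmallCubic (G : SGraph) : Prop :=
  G.Connected ∧ G.IsCubic ∧
    (Fintype.card G.V = 1 ∨ Fintype.card G.V = 2 ∨ (Fintype.card G.V = 4 ∧ G.SemiEdgeFree))

/-- Names of the nodes of the diagram. -/
inductive Node where
  | F11 | F30 | W00300 | W01110 | W10201 | W01102 | W20102 | K4 | SG | DG | WG | LC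
  deriving DecidableEq

/-- The graph at a node of the diagram. -/
def Node.graph : Node → SGraph
  | .F11 => F 1 1
  | .F30 => F 3 0
  | .W00300 => W 0 0 3 0 0
  | .W01110 => W 0 1 1 1 0
  | .W10201 => W 1 0 2 0 1
  | .W01102 => W 0 1 1 0 2
  | .W20102 => W 2 0 1 0 2
  | .K4 => SGraph.K4
  | .SG => SGraph.SG
  | .DG => SGraph.DG
  | .WG => SGraph.WG
  | .LC => SGraph.LC

/-- The green arrows of the diagram (covering projections). -/
inductive Green : Node → Node → Prop where
  | K4_W10201 : Green .K4 .W10201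
  | SG_W01110 : Green .SG .W01110
  | SG_W01102 : Green .SG .W01102
  | DG_W00300 : Green .DG .W00300
  | DG_W01110 : Green .DG .W01110
  | DG_W10201 : Green .DG .W10201
  | DG_W01102 : Green .DG .W01102
  | DG_W20102 : Green .DG .W20102
  | WG_F11 : Green .WG .F11
  | W00300_F30 : Green .W00300 .F30
  | W00300_F11 : Green .W00300 .F11
  | W01110_F11 : Green .W01110 .F11
  | W10201_F30 : Green .W10201 .F30
  | W10201_F11 : Green .W10201 .F11
  | W20102_F30 : Green .W20102 .F30

/-- The purple arrows of the diagram (`▷` without a covering projection). -/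
inductive Purple : Node → Node → Prop where
  | W20102_W01102 : Purple .W20102 .W01102
  | W01102_W01110 : Purple .W01102 .W01110
  | F30_F11 : Purple .F30 .F11

end SGraph

/-! On the twelve nodes both relations are compared with explicit finite tables, `Node.covered` and
`Node.weaker`; once these are correct, the partial orders and Hasse diagrams are finite checks.

Positive entries: covering projections compose, and the green arrows are explicit maps. For ▷ the
conditions on loops and semi-edges may be dropped from the second map. A simple graph has neither,
so a `WeakProjection`, which may fold two semi-edges onto a loop, still turns its coverings into
coverings (`stronger_of_weakProjection`). This gives the purple arrows.

Negative entries: by transitivity twenty extremal pairs (A, B) suffice, each refuted by a simple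
graph that covers A and not B. There are two kinds of obstruction. A covering colours the vertices
so that the number of neighbours of each colour is prescribed, which a backtracking search can
exclude (`not_covers_of_refute`). And over a semi-edge a graph without semi-edges has a perfect
matching, so fibres are even, and a bridge cutting off an odd set belongs to that matching
(`not_covers_F30_of_cut`, `not_covers_F11_of_cut`). Where ▷ holds and a covering does not exist,
semi-edges leave no room for a loop (`LacksLoop`).

Classification: a graph is determined by its numbers of edges of each kind between labelled
vertices, and the degree equations have finitely many solutions. Uniqueness of the node is
antisymmetry of covering.

For an arbitrary B, the 3-fold and 4-fold cyclic lifts of A are simple. If both cover B, then |B|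
divides |A|, and parity excludes semi-edges when |B| = 4. So B is a node up to isomorphism, and the
tables agree at nodes without semi-edges. -/

namespace SGraph

/-! ### Multiplicities, weak projections and composition -/

section
variable {G H K : SGraph}

/-- A loop counts its two coinciding ends separately, so one formula serves loops and normal edges.
-/
theorem mult_of_ends {e : G.E} (he : ¬ G.IsSemi e) {a b : G.V} (h : G.ends e = s(a, b)) (v : G.V) :
    G.mult v e = (if a = v then 1 else 0) + (if b = v then 1 else 0) := by
  unfold mult IsLoop
  rw [h]
  simp only [Sym2.mem_iff, Sym2.mk_isDiag_iff, he, not_false_eq_true, and_true]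
  simp only [eq_comm (a := v)]
  by_cases h1 : a = v
  · subst h1
    by_cases h2 : b = a
    · simp [h2]
    · simp [h2, Ne.symm h2]
  · by_cases h2 : b = v
    · subst h2; simp [h1]
    · simp [h1, h2]

theorem mult_of_isSemi {e : G.E} (he : G.IsSemi e) (v : G.V) :
    G.mult v e = if G.ends e = s(v, v) then 1 else 0 := by
  have hd := G.isDiag_of_isSemi e he
  unfold mult IsLoop
  generalize G.ends e = z at *
  induction z with | _ a b
  have : a = b := hd
  subst this
  simp [he, eq_comm]

theorem mult_eq_zero {e : G.E} {v : G.V} (h : v ∉ G.ends e) : G.mult v e = 0 := by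
  simp [mult, h]

theorem mult_pos {e : G.E} {v : G.V} (h : v ∈ G.ends e) : 0 < G.mult v e := by
  simp only [mult, h, if_true]; split_ifs <;> norm_num

theorem mult_eq_one_of_isSemi {e : G.E} {v : G.V} (h : v ∈ G.ends e) (he : G.IsSemi e) :
    G.mult v e = 1 := by
  simp [mult, h, IsLoop, he]

theorem mult_eq_one_of_not_isDiag {e : G.E} {v : G.V} (h : v ∈ G.ends e)
    (he : ¬ (G.ends e).IsDiag) : G.mult v e = 1 := by
  simp [mult, h, IsLoop, he]

/-- The part of a covering projection that does not tell loops from pairs of semi-edges. -/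
structure WeakProjection (G H : SGraph) where
  onV : G.V → H.V
  onE : G.E → H.E
  surjective_onV : Function.Surjective onV
  ends_onE : ∀ e, H.ends (onE e) = (G.ends e).map onV
  local_bij : ∀ (v : G.V) (f : H.E), onV v ∈ H.ends f →
    ∑ e with onE e = f, G.mult v e = H.mult (onV v) f

def CoveringProjection.toWeak (p : CoveringProjection G H) : WeakProjection G H :=
  ⟨p.onV, p.onE, p.surjective_onV, p.ends_onE, p.local_bij⟩

namespace WeakProjection

theorem sum_mult (p : WeakProjection G H) (v : G.V) (f : H.E) :
    ∑ e with p.onE e = f, G.mult v e = H.mult (p.onV v) f := by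
  by_cases h : p.onV v ∈ H.ends f
  · exact p.local_bij v f h
  · rw [mult_eq_zero h]
    refine Finset.sum_eq_zero fun e he => mult_eq_zero fun hv => h ?_
    rw [← (Finset.mem_filter.1 he).2, p.ends_onE]
    exact Sym2.mem_map.2 ⟨v, hv, rfl⟩

/-- A missed edge would have an empty preimage, of total multiplicity 0, although its multiplicity
at an end is positive. Like `degree_onV`, this makes a field of `CoveringProjection` redundant. -/
theorem surjective_onE (p : WeakProjection G H) : Function.Surjective p.onE := by
  intro f
  obtain ⟨x, hx⟩ : ∃ x, x ∈ H.ends f := by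
    induction H.ends f with | _ a b => exact ⟨a, by simp⟩
  obtain ⟨v, rfl⟩ := p.surjective_onV x
  have h1 := p.sum_mult v f
  have h2 := mult_pos hx
  by_contra! h
  rw [Finset.filter_false_of_mem (fun e _ => h e), Finset.sum_empty] at h1
  omega

theorem degree_onV (p : WeakProjection G H) (v : G.V) : H.degree (p.onV v) = G.degree v := by
  unfold degree
  simp_rw [← p.sum_mult v]
  exact Finset.sum_fiberwise _ _ _

def toCovering (p : WeakProjection G H) (hs : ∀ e, G.IsSemi e → H.IsSemi (p.onE e))
    (hl : ∀ e, G.IsLoop e → H.IsLoop (p.onE e)) : CoveringProjection G H :=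
  ⟨p.onV, p.onE, p.surjective_onV, p.surjective_onE, p.degree_onV, hs, hl, p.ends_onE, p.local_bij⟩

def comp (q : WeakProjection H K) (p : WeakProjection G H) : WeakProjection G K where
  onV := q.onV ∘ p.onV
  onE := q.onE ∘ p.onE
  surjective_onV := q.surjective_onV.comp p.surjective_onV
  ends_onE e := by simp [q.ends_onE, p.ends_onE, Sym2.map_map]
  local_bij v f _ := by
    simp only [Function.comp]
    -- The edges over `f` are grouped by their image `f'` in the middle graph; only the groups with
    -- `q.onE f' = f` contribute.
    rw [← q.sum_mult, Finset.sum_filter, Finset.sum_filter, ← Finset.sum_fiberwise _ p.onE]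
    refine Finset.sum_congr rfl fun f' _ => ?_
    rw [← p.sum_mult v f', ← Finset.sum_filter_add_sum_filter_not _ (fun _ => q.onE f' = f)]
    by_cases h : q.onE f' = f
    · rw [if_pos h]
      simp only [h, not_true_eq_false, Finset.filter_true, Finset.filter_false, Finset.sum_empty,
        add_zero]
      refine Finset.sum_congr rfl fun e he => ?_
      rw [(Finset.mem_filter.1 he).2, if_pos h]
    · rw [if_neg h]
      simp only [h, not_false_eq_true, Finset.filter_true, Finset.filter_false, Finset.sum_empty,
        zero_add]
      refine Finset.sum_eq_zero fun e he => ?_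
      rw [(Finset.mem_filter.1 he).2, if_neg h]

end WeakProjection

theorem Covers.trans (h₁ : G.Covers H) (h₂ : H.Covers K) : G.Covers K := by
  obtain ⟨_, ⟨p⟩⟩ := h₁
  obtain ⟨hK, ⟨q⟩⟩ := h₂
  exact ⟨hK, ⟨(q.toWeak.comp p.toWeak).toCovering
    (fun e he => q.isSemi_onE _ (p.isSemi_onE e he))
    (fun e he => q.isLoop_onE _ (p.isLoop_onE e he))⟩⟩

theorem Covers.stronger (h : G.Covers H) : G.Stronger H := fun _ _ hK => hK.trans h

theorem Stronger.trans (h₁ : G.Stronger H) (h₂ : H.Stronger K) : G.Stronger K :=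
  fun L hL h => h₂ L hL (h₁ L hL h)

/-- For a simple source the conditions on loops and semi-edges hold vacuously, so the composite with
a weak projection is a full covering projection. -/
theorem stronger_of_weakProjection (hK : K.Connected) (q : WeakProjection H K) :
    H.Stronger K := by
  rintro G ⟨hl, hs, _⟩ ⟨_, ⟨p⟩⟩
  exact ⟨hK, ⟨(q.comp p.toWeak).toCovering (fun e he => absurd he (hs e))
    (fun e he => absurd he (hl e))⟩⟩

theorem Iso.isLoop_iff (φ : G.Iso H) (e : G.E) : H.IsLoop (φ.onE e) ↔ G.IsLoop e := by
  unfold IsLoop IsSemi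
  rw [φ.ends_onE, φ.isSemi_onE, Sym2.isDiag_map φ.onV.injective]

theorem Iso.mult (φ : G.Iso H) (v : G.V) (e : G.E) :
    H.mult (φ.onV v) (φ.onE e) = G.mult v e := by
  have : φ.onV v ∈ H.ends (φ.onE e) ↔ v ∈ G.ends e := by
    rw [φ.ends_onE, Sym2.mem_map]; simp
  simp only [SGraph.mult, this, φ.isLoop_iff]

def Iso.toWeak (φ : G.Iso H) : WeakProjection G H where
  onV := φ.onV
  onE := φ.onE
  surjective_onV := φ.onV.surjective
  ends_onE := φ.ends_onE
  local_bij v f _ := by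
    obtain ⟨e, rfl⟩ := φ.onE.surjective f
    simp [Finset.filter_eq', φ.mult]

theorem Iso.covers (φ : G.Iso H) (hH : H.Connected) : G.Covers H :=
  ⟨hH, ⟨φ.toWeak.toCovering (fun e he => (φ.isSemi_onE e).trans he)
    (fun e he => (φ.isLoop_iff e).2 he)⟩⟩

def Iso.symm (φ : G.Iso H) : H.Iso G where
  onV := φ.onV.symm
  onE := φ.onE.symm
  ends_onE e := by
    obtain ⟨e, rfl⟩ := φ.onE.surjective e
    simp [φ.ends_onE, Sym2.map_map]
  isSemi_onE e := by
    obtain ⟨e, rfl⟩ := φ.onE.surjective e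
    simp [φ.isSemi_onE]

theorem Covers.refl (hG : G.Connected) : G.Covers G :=
  Iso.covers ⟨Equiv.refl _, Equiv.refl _, fun e => by simp, fun _ => rfl⟩ hG

/-! ### Fibres -/

/-- The preimage of a normal edge is a perfect matching between the fibres of its ends: each vertex
over `x` meets one edge over `f`, and each such edge has one end over `x`. Applied to both ends,
this makes fibres over adjacent vertices equal in size. -/
theorem WeakProjection.card_fiber_eq_of_edge (p : WeakProjection G H) {f : H.E}
    (hf : ¬ (H.ends f).IsDiag) {x : H.V} (hx : x ∈ H.ends f) :
    Finset.card {v | p.onV v = x} = Finset.card {e | p.onE e = f} := by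
  have h1 : ∑ v with p.onV v = x, ∑ e with p.onE e = f, G.mult v e =
      Finset.card {v | p.onV v = x} := by
    rw [Finset.card_eq_sum_ones]
    refine Finset.sum_congr rfl fun v hv => ?_
    have hv := (Finset.mem_filter.1 hv).2
    rw [p.sum_mult, hv, mult_eq_one_of_not_isDiag hx hf]
  rw [← h1, Finset.sum_comm, Finset.card_eq_sum_ones]
  refine Finset.sum_congr rfl fun e he => ?_
  have he := (Finset.mem_filter.1 he).2
  have hz := p.ends_onE e
  rw [he] at hz
  have hns : ¬ G.IsSemi e := fun hs => hf (by
    have := G.isDiag_of_isSemi e hs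
    rw [hz]
    generalize G.ends e = z at *
    induction z with | _ a b
    have hab : a = b := this
    subst hab; simp)
  obtain ⟨a, b, hab⟩ : ∃ a b, G.ends e = s(a, b) := by
    induction G.ends e with | _ a b => exact ⟨a, b, rfl⟩
  rw [hab, Sym2.map_mk] at hz
  rw [hz] at hf hx
  simp only [Sym2.mk_isDiag_iff] at hf
  simp only [mult_of_ends hns hab, Finset.sum_add_distrib, Finset.sum_ite_eq, Finset.mem_filter,
    Finset.mem_univ, true_and]
  rcases Sym2.mem_iff.1 hx with rfl | rfl
  · simp [Ne.symm hf]
  · simp [hf]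

theorem WeakProjection.card_fiber_eq (p : WeakProjection G H) (hH : H.Connected) (x y : H.V) :
    Finset.card {v | p.onV v = x} = Finset.card {v | p.onV v = y} := by
  have h := hH.preconnected x y
  rw [SimpleGraph.reachable_iff_reflTransGen] at h
  induction h with
  | refl => rfl
  | tail _ h ih =>
    rw [ih]
    obtain ⟨⟨f, hf⟩, hne⟩ := (SimpleGraph.fromEdgeSet_adj _).1 h
    rw [p.card_fiber_eq_of_edge (f := f) (by rw [hf]; exact hne) (by rw [hf]; simp),
      p.card_fiber_eq_of_edge (f := f) (by rw [hf]; exact hne) (by rw [hf]; simp)]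

theorem WeakProjection.card_eq (p : WeakProjection G H) (hH : H.Connected) (x : H.V) :
    Fintype.card G.V = Fintype.card H.V * Finset.card {v | p.onV v = x} := by
  rw [← Finset.card_univ, Finset.card_eq_sum_card_fiberwise (f := p.onV) (t := Finset.univ)
    (fun _ _ => Finset.mem_coe.2 (Finset.mem_univ _)),
    Finset.sum_congr rfl (fun y _ => p.card_fiber_eq hH y x)]
  simp

/-- If no edge over the semi-edge `f` leaves the vertex set `X`, which lies over the end of `f`,
then `X` has an even number of elements. -/
theorem WeakProjection.even_card_of_isSemi (p : WeakProjection G H) (hG : G.SemiEdgeFree)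
    {f : H.E} (hf : H.IsSemi f) (X : Finset G.V) (hX : ∀ v ∈ X, p.onV v ∈ H.ends f)
    (h : ∀ e, p.onE e = f → ∀ u v, G.ends e = s(u, v) → (u ∈ X ↔ v ∈ X)) : Even X.card := by
  have h1 : ∑ v ∈ X, ∑ e with p.onE e = f, G.mult v e = X.card := by
    rw [Finset.card_eq_sum_ones]
    exact Finset.sum_congr rfl fun v hv => by
      rw [p.sum_mult, mult_eq_one_of_isSemi (hX v hv) hf]
  rw [← h1, Finset.sum_comm]
  -- After the exchange of sums an edge over `f` contributes its number of ends in `X`, which is 0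
  -- or 2.
  refine Finset.even_sum _ fun e he => ?_
  obtain ⟨a, b, hab⟩ : ∃ a b, G.ends e = s(a, b) := by
    induction G.ends e with | _ a b => exact ⟨a, b, rfl⟩
  have := h e (Finset.mem_filter.1 he).2 a b hab
  simp only [mult_of_ends (hG e) hab, Finset.sum_add_distrib, Finset.sum_ite_eq, this]
  split_ifs <;> decide

theorem WeakProjection.even_card_fiber (p : WeakProjection G H) (hG : G.SemiEdgeFree)
    {f : H.E} (hf : H.IsSemi f) {x : H.V} (hx : x ∈ H.ends f) :
    Even (Finset.card {v | p.onV v = x}) := by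
  have hz : H.ends f = s(x, x) := by
    have := H.isDiag_of_isSemi f hf
    generalize H.ends f = z at *
    induction z with | _ a b
    have hab : a = b := this
    subst hab
    simp at hx; simp [hx]
  refine p.even_card_of_isSemi hG hf _ (fun v hv => by simp at hv; rwa [hv]) ?_
  intro e he u v huv
  have := p.ends_onE e
  rw [he, huv, hz, Sym2.map_mk, Sym2.eq_iff] at this
  simp only [Finset.mem_filter, Finset.mem_univ, true_and]
  rcases this with ⟨h1, h2⟩ | ⟨h1, h2⟩ <;> simp [← h1, ← h2]

/-! ### Degree matrices -/

/-- The degree from the vertex `x` to the vertex `w`. -/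
def adj (H : SGraph) (x w : H.V) : ℕ := ∑ f with H.ends f = s(x, w), H.mult x f

/-- Summing local bijectivity over the edges between `p.onV v` and `w` gives equality for the full
neighbourhood of `v`. The inequality allows partial lists of edges, so that a search can stay inside
a small part of the graph. -/
theorem WeakProjection.card_le_adj (p : WeakProjection G H) (v : G.V) (w : H.V)
    (L : List (G.E × G.V)) (hL : (L.map Prod.fst).Nodup)
    (hE : ∀ a ∈ L, G.ends a.1 = s(v, a.2)) :
    L.countP (fun a => p.onV a.2 = w) ≤ H.adj (p.onV v) w := by
  have h1 : H.adj (p.onV v) w =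
      ∑ e with H.ends (p.onE e) = s(p.onV v, w), G.mult v e := by
    unfold adj
    simp_rw [← p.sum_mult v]
    rw [Finset.sum_filter, Finset.sum_filter, ← Finset.sum_fiberwise _ p.onE]
    refine Finset.sum_congr rfl fun f _ => ?_
    split_ifs with hf
    · exact Finset.sum_congr rfl fun e he => by
        rw [(Finset.mem_filter.1 he).2, if_pos hf]
    · exact (Finset.sum_eq_zero fun e he => by
        rw [(Finset.mem_filter.1 he).2, if_neg hf]).symm
  have hnd : ((L.filter (fun a => p.onV a.2 = w)).map Prod.fst).Nodup :=
    hL.sublist (List.filter_sublist.map _)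
  rw [h1, List.countP_eq_length_filter, ← List.length_map (f := Prod.fst),
    ← List.toFinset_card_of_nodup hnd, Finset.card_eq_sum_ones]
  refine (Finset.sum_le_sum (g := fun e => G.mult v e) fun e he => ?_).trans
    (Finset.sum_le_sum_of_subset fun e he => ?_)
  all_goals
    simp only [List.mem_toFinset, List.mem_map, List.mem_filter, decide_eq_true_eq] at he
    obtain ⟨a, ⟨ha, hw⟩, rfl⟩ := he
  · exact mult_pos (by rw [hE a ha]; simp)
  · simp [p.ends_onE, hE a ha, hw]

/-- The partial colouring `l` of the numbers below `l.length` violates no constraint that involves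
the last of these numbers: a constraint `(v, us)` says that at most `M x w` members of `us` have
colour `w` if `v` has colour `x`. -/
def consistent {m : ℕ} (M : Fin m → Fin m → ℕ) (cons : List (ℕ × List ℕ)) (l : List (Fin m)) :
    Bool :=
  cons.all fun c => !(c.1 + 1 == l.length || c.2.any (· + 1 == l.length)) || match l[c.1]? with
    | none => true
    | some x => (List.finRange m).all fun w => c.2.countP (fun u => l[u]? == some w) ≤ M x w

/-- Backtracking search, which finds that no consistent extension of `l` by `n` further colours
exists. -/
def refute {m : ℕ} (M : Fin m → Fin m → ℕ) (cons : List (ℕ × List ℕ)) :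
    ℕ → List (Fin m) → Bool
  | 0, l => !consistent M cons l
  | n + 1, l => !consistent M cons l ||
      (List.finRange m).all fun a => refute M cons n (l ++ [a])

/-- All initial segments of a genuine colouring `g` are consistent, so the branch of the search that
follows `g` is never cut off. -/
theorem refute_eq_false {m : ℕ} {M : Fin m → Fin m → ℕ} {cons : List (ℕ × List ℕ)}
    (g : ℕ → Fin m)
    (hg : ∀ c ∈ cons, ∀ w, c.2.countP (fun u => g u = w) ≤ M (g c.1) w) (n k : ℕ) :
    refute M cons n ((List.range k).map g) = false := by
  have hc : ∀ k, consistent M cons ((List.range k).map g) = true := by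
    intro k
    unfold consistent
    rw [List.all_eq_true]
    intro c hcc
    rw [Bool.or_eq_true]
    right
    split
    · rfl
    · rename_i x hx
      simp only [List.getElem?_map, Option.map_eq_some_iff,
        List.getElem?_eq_some_iff] at hx
      obtain ⟨a, ⟨h1, h2⟩, rfl⟩ := hx
      simp only [List.getElem_range] at h2
      subst h2
      rw [List.all_eq_true]
      intro w _
      rw [decide_eq_true_eq]
      refine le_trans (List.countP_mono_left fun u _ hu => ?_) (hg c hcc w)
      simp only [beq_iff_eq, List.getElem?_map, Option.map_eq_some_iff,
        List.getElem?_eq_some_iff] at hu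
      obtain ⟨a, ⟨h1, h2⟩, h3⟩ := hu
      simp only [List.getElem_range] at h2
      subst h2
      simpa using h3
  induction n generalizing k with
  | zero => simp [refute, hc]
  | succ n ih =>
    have := ih (k + 1)
    rw [List.range_succ, List.map_append, List.map_singleton] at this
    simp only [refute, hc, Bool.not_true, Bool.false_or, List.all_eq_false, Bool.not_eq_true]
    exact ⟨g k, List.mem_finRange _, this⟩

end

/-! ### Lifts -/

/-- The graph over `A` with fibres `ι`, where `σ e i` is the index at the second end of the edge
over `e` whose first end has index `i`. -/
def lift (A : SGraph) {ι : Type} [Fintype ι] [DecidableEq ι] (s t : A.E → A.V)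
    (σ : A.E → Equiv.Perm ι) : SGraph where
  V := A.V × ι
  E := A.E × ι
  ends e := s((s e.1, e.2), (t e.1, σ e.1 e.2))
  isSemi _ := false
  isDiag_of_isSemi := by simp

section
variable {A : SGraph} {ι : Type} [Fintype ι] [DecidableEq ι] {s t : A.E → A.V}
  {σ : A.E → Equiv.Perm ι}

theorem lift_semiEdgeFree : (A.lift s t σ).SemiEdgeFree := fun _ => by simp [lift, IsSemi]

theorem lift_covers [Nonempty ι] (hA : A.SemiEdgeFree) (hc : A.Connected)
    (h : ∀ e, A.ends e = s(s e, t e)) : (A.lift s t σ).Covers A := by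
  refine ⟨hc, ⟨WeakProjection.toCovering ⟨Prod.fst, Prod.fst,
    Prod.fst_surjective, fun e => by rw [h]; rfl, ?_⟩
    (fun e he => absurd he (lift_semiEdgeFree e)) ?_⟩⟩
  · rintro ⟨x, i⟩ f -
    have h1 : ∀ e : A.E × ι, (A.lift s t σ).mult (x, i) e =
        (if (s e.1, e.2) = (x, i) then 1 else 0) +
          (if (t e.1, σ e.1 e.2) = (x, i) then 1 else 0) :=
      fun e => mult_of_ends (G := A.lift s t σ) (lift_semiEdgeFree _) rfl _
    rw [mult_of_ends (hA f) (h f)]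
    refine Eq.trans (b := ∑ e : A.E × ι, if e.1 = f then (A.lift s t σ).mult (x, i) e else 0)
      (Finset.sum_filter _ _) ?_
    rw [Fintype.sum_prod_type, Finset.sum_eq_single f (fun b _ hb => by simp [hb]) (by simp)]
    simp only [h1, if_true, Prod.mk.injEq, Finset.sum_add_distrib]
    congr 1
    · by_cases hs : s f = x <;> simp [hs]
    · by_cases ht : t f = x
      · simp only [ht, true_and, if_true]
        -- The only edge over `f` that arrives at index `i` starts at the index `(σ f).symm i`.
        rw [Finset.sum_eq_single ((σ f).symm i)]
        · simp
        · intro j _ hj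
          rw [if_neg]
          rintro rfl
          simp at hj
        · simp
      · simp [ht]
  · rintro ⟨e, i⟩ ⟨he, -⟩
    refine ⟨?_, hA e⟩
    rw [h]
    exact congrArg Prod.fst (he : (s e, i) = (t e, σ e i))

/-- A fixed point of the permutation on a loop would give a loop, and a 2-cycle a pair of parallel
edges. Parallel edges of `A`, oriented alike by `h`, lift to parallel edges exactly where their
permutations agree. -/
theorem lift_isSimple (h : ∀ e e', s(s e, t e) = s(s e', t e') → s e = s e' ∧ t e = t e')
    (hloop : ∀ e, s e = t e → ∀ i, σ e i ≠ i ∧ σ e (σ e i) ≠ i)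
    (hpar : ∀ e e', e ≠ e' → s e = s e' → t e = t e' → s e ≠ t e ∧ ∀ i, σ e i ≠ σ e' i) :
    (A.lift s t σ).IsSimple := by
  refine ⟨?_, lift_semiEdgeFree, ?_⟩
  · rintro ⟨e, i⟩ ⟨he, -⟩
    have he : (s e, i) = (t e, σ e i) := he
    rw [Prod.mk.injEq] at he
    exact (hloop e he.1 i).1 he.2.symm
  · rintro ⟨e, i⟩ ⟨e', i'⟩ he
    have he : s((s e, i), (t e, σ e i)) = s((s e', i'), (t e', σ e' i')) := he
    have h1 := congrArg (Sym2.map Prod.fst) he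
    simp only [Sym2.map_mk] at h1
    obtain ⟨hs, ht⟩ := h e e' h1
    by_cases hee : e = e'
    · subst hee
      rcases Sym2.eq_iff.1 he with ⟨h2, -⟩ | ⟨h2, h3⟩
      · exact Prod.ext rfl (Prod.ext_iff.1 h2).2
      · simp only [Prod.mk.injEq] at h2 h3
        refine absurd ?_ (hloop e h2.1 i').2
        rw [← h2.2, h3.2]
    · obtain ⟨h4, h5⟩ := hpar e e' hee hs ht
      rcases Sym2.eq_iff.1 he with ⟨h2, h3⟩ | ⟨h2, h3⟩
      · simp only [Prod.mk.injEq] at h2 h3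
        refine absurd ?_ (h5 i)
        rw [h3.2, h2.2]
      · simp only [Prod.mk.injEq] at h2 h3
        exact absurd (h2.1.trans ht.symm) h4

end

/-- For every edge the two ends in some order and a voltage. -/
structure Volt (A : SGraph) where
  src : A.E → A.V
  tgt : A.E → A.V
  volt : A.E → ℕ
  ends_eq : ∀ e, A.ends e = s(src e, tgt e)
  semiEdgeFree : A.SemiEdgeFree
  src_eq : ∀ e e', s(src e, tgt e) = s(src e', tgt e') → src e = src e' ∧ tgt e = tgt e'
  volt_le : ∀ e, volt e ≤ 2
  volt_loop : ∀ e, src e = tgt e → volt e = 1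
  volt_parallel : ∀ e e', e ≠ e' → src e = src e' → tgt e = tgt e' →
    src e ≠ tgt e ∧ volt e ≠ volt e'

/-- The cyclic lift with fibres of size `k`. -/
def Volt.lift {A : SGraph} (T : Volt A) (k : ℕ) [NeZero k] : SGraph :=
  A.lift T.src T.tgt (fun e => Equiv.addRight (Fin.ofNat k (T.volt e)))

section
variable {A : SGraph} (T : Volt A)

theorem Volt.lift_covers (k : ℕ) [NeZero k] (hA : A.Connected) : (T.lift k).Covers A :=
  SGraph.lift_covers T.semiEdgeFree hA T.ends_eq

/-- For `k ≥ 3` the shift by 1 on a loop has neither fixed points nor 2-cycles, and distinct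
voltages at most 2 stay distinct modulo `k`. -/
theorem Volt.lift_isSimple (k : ℕ) [NeZero k] (hk : 2 < k) : (T.lift k).IsSimple := by
  refine SGraph.lift_isSimple T.src_eq (fun e he i => ?_) (fun e e' h1 h2 h3 => ?_)
  · rw [T.volt_loop e he]
    obtain ⟨i, hi⟩ := i
    simp only [Equiv.coe_addRight, ne_eq, Fin.ext_iff, Fin.val_add, Fin.ofNat]
    rw [Nat.mod_eq_of_lt (by omega : 1 < k), Nat.mod_add_mod]
    refine ⟨fun h => ?_, fun h => ?_⟩
    · rcases Nat.lt_or_ge (i + 1) k with h1 | h1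
      · rw [Nat.mod_eq_of_lt h1] at h; omega
      · rw [Nat.mod_eq_sub_mod h1, Nat.mod_eq_of_lt (by omega)] at h; omega
    · rcases Nat.lt_or_ge (i + 1 + 1) k with h1 | h1
      · rw [Nat.mod_eq_of_lt h1] at h; omega
      · rw [Nat.mod_eq_sub_mod h1, Nat.mod_eq_of_lt (by omega)] at h; omega
  · obtain ⟨h4, h5⟩ := T.volt_parallel e e' h1 h2 h3
    refine ⟨h4, fun i hi => h5 ?_⟩
    have := T.volt_le e
    have := T.volt_le e'
    simp only [Equiv.coe_addRight, add_right_inj, Fin.ext_iff, Fin.ofNat] at hi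
    rwa [Nat.mod_eq_of_lt (by omega), Nat.mod_eq_of_lt (by omega)] at hi

theorem Volt.lift_semiEdgeFree (k : ℕ) [NeZero k] : (T.lift k).SemiEdgeFree :=
  SGraph.lift_semiEdgeFree

theorem Volt.card_lift (k : ℕ) [NeZero k] :
    Fintype.card (T.lift k).V = Fintype.card A.V * k := by
  refine (Fintype.card_prod A.V (Fin k)).trans ?_
  rw [Fintype.card_fin]

end

/-! ### The twelve graphs -/

/-- Passing repeatedly to a smaller neighbour ends at 0. The hypothesis turns connectedness into a
finite check. -/
theorem connected_of_forall_lt {n : ℕ} {E : Type} [Fintype E] [DecidableEq E]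
    (ends : E → Sym2 (Fin (n + 1))) (isSemi : E → Bool) (h)
    (hp : ∀ v : Fin (n + 1), v ≠ 0 → ∃ e, ∃ u < v, ends e = s(u, v)) :
    (SGraph.mk (Fin (n + 1)) E ends isSemi h).Connected := by
  have h0 : ∀ v : Fin (n + 1),
      (SimpleGraph.fromEdgeSet (Set.range ends)).Reachable 0 v := by
    intro v
    induction v using WellFoundedLT.induction with
    | ind v ih =>
      by_cases hv : v = 0
      · rw [hv]
      · obtain ⟨e, u, hu, he⟩ := hp v hv
        exact (ih u hu).trans (SimpleGraph.Adj.reachable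
          ((SimpleGraph.fromEdgeSet_adj _).2 ⟨⟨e, he⟩, hu.ne⟩))
  exact { preconnected := fun u v => (h0 u).symm.trans (h0 v) }

theorem Node.graph_connected (a : Node) : a.graph.Connected := by
  cases a <;> exact connected_of_forall_lt _ _ _ (by decide +kernel)

theorem Node.graph_isCubic (a : Node) : a.graph.IsCubic := by
  cases a <;> (unfold IsCubic; decide +kernel)

theorem Node.graph_isSmallCubic (a : Node) : a.graph.IsSmallCubic := by
  refine ⟨a.graph_connected, a.graph_isCubic, ?_⟩
  cases a <;> (unfold SemiEdgeFree; decide +kernel)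

def IsVolt (A : SGraph) (s t : A.E → A.V) (w : A.E → ℕ) : Prop :=
  (∀ e, A.ends e = s(s e, t e) ∧ A.isSemi e = false ∧ w e ≤ 2 ∧ (s e = t e → w e = 1)) ∧
    ∀ e e', (s(s e, t e) = s(s e', t e') → s e = s e' ∧ t e = t e') ∧
      (e ≠ e' → s e = s e' → t e = t e' → s e ≠ t e ∧ w e ≠ w e')

instance (A : SGraph) (s t : A.E → A.V) (w : A.E → ℕ) : Decidable (A.IsVolt s t w) := by
  unfold IsVolt; infer_instance

def Volt.of {A : SGraph} (s t : A.E → A.V) (w : A.E → ℕ) (h' : decide (A.IsVolt s t w) = true) :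
    Volt A :=
  have h : A.IsVolt s t w := of_decide_eq_true h'
  { src := s
    tgt := t
    volt := w
    ends_eq e := (h.1 e).1
    semiEdgeFree e := by simp [IsSemi, (h.1 e).2.1]
    src_eq e e' := (h.2 e e').1
    volt_le e := (h.1 e).2.2.1
    volt_loop e := (h.1 e).2.2.2
    volt_parallel e e' := (h.2 e e').2 }

/-- `K4` is simple already, so zero voltages do; the lift is a disjoint union of copies, and simple
graphs need not be connected. -/
def voltK4 : Volt Node.K4.graph :=
  Volt.of (![0, 0, 0, 1, 1, 2] : Fin 6 → Fin 4) (![1, 2, 3, 2, 3, 3] : Fin 6 → Fin 4)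
    (![0, 0, 0, 0, 0, 0] : Fin 6 → ℕ) (by decide +kernel)

def voltSG : Volt Node.SG.graph :=
  Volt.of (![0, 0, 1, 1, 2, 3] : Fin 6 → Fin 4) (![0, 1, 2, 2, 3, 3] : Fin 6 → Fin 4)
    (![1, 0, 0, 1, 0, 1] : Fin 6 → ℕ) (by decide +kernel)

def voltDG : Volt Node.DG.graph :=
  Volt.of (![0, 0, 1, 2, 2, 3] : Fin 6 → Fin 4) (![1, 1, 2, 3, 3, 0] : Fin 6 → Fin 4)
    (![0, 1, 0, 0, 1, 0] : Fin 6 → ℕ) (by decide +kernel)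

def voltWG : Volt Node.WG.graph :=
  Volt.of (![0, 0, 1, 1, 2, 2] : Fin 6 → Fin 4) (![0, 1, 2, 3, 3, 3] : Fin 6 → Fin 4)
    (![1, 0, 0, 0, 0, 1] : Fin 6 → ℕ) (by decide +kernel)

def voltLC : Volt Node.LC.graph :=
  Volt.of (![0, 0, 0, 1, 2, 3] : Fin 6 → Fin 4) (![1, 2, 3, 1, 2, 3] : Fin 6 → Fin 4)
    (![0, 0, 0, 1, 1, 1] : Fin 6 → ℕ) (by decide +kernel)

def voltW00300 : Volt Node.W00300.graph :=
  Volt.of (fun _ => (0 : Fin 2)) (fun _ => (1 : Fin 2))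
    (Sum.elim (fun _ => 0) (Sum.elim (fun i : Fin 3 => i.1) (fun _ => 0))) (by decide +kernel)

def voltW01110 : Volt Node.W01110.graph :=
  Volt.of
    (Sum.elim (fun _ => 0) (Sum.elim (fun _ => 0) (fun _ => 1)) :
      (Fin 0 ⊕ Fin 1) ⊕ Fin 1 ⊕ Fin 1 ⊕ Fin 0 → Fin 2)
    (Sum.elim (fun _ => 0) (Sum.elim (fun _ => 1) (fun _ => 1)) :
      (Fin 0 ⊕ Fin 1) ⊕ Fin 1 ⊕ Fin 1 ⊕ Fin 0 → Fin 2)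
    (Sum.elim (fun _ => 1) (Sum.elim (fun _ => 0) (fun _ => 1))) (by decide +kernel)

theorem Node.exists_volt {a : Node} (ha : a.graph.SemiEdgeFree) : Nonempty (Volt a.graph) := by
  cases a
  case F11 => exact absurd rfl (ha (Sum.inl (0 : Fin 1)))
  case F30 => exact absurd rfl (ha (Sum.inl (0 : Fin 3)))
  case W00300 => exact ⟨voltW00300⟩
  case W01110 => exact ⟨voltW01110⟩
  case W10201 => exact absurd rfl (ha (Sum.inl (Sum.inl (0 : Fin 1))))
  case W01102 => exact absurd rfl (ha (Sum.inr (Sum.inr (Sum.inr (0 : Fin 2)))))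
  case W20102 => exact absurd rfl (ha (Sum.inl (Sum.inl (0 : Fin 2))))
  case K4 => exact ⟨voltK4⟩
  case SG => exact ⟨voltSG⟩
  case DG => exact ⟨voltDG⟩
  case WG => exact ⟨voltWG⟩
  case LC => exact ⟨voltLC⟩

/-! ### Positive arrows -/

/-- A computable form of weak projections. -/
def IsWeakProjection {G H : SGraph} (onV : G.V → H.V) (onE : G.E → H.E) : Prop :=
  (∀ x, ∃ v, onV v = x) ∧ (∀ e, H.ends (onE e) = (G.ends e).map onV) ∧
    ∀ (v : G.V) (f : H.E), onV v ∈ H.ends f →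
      ∑ e with onE e = f, G.mult v e = H.mult (onV v) f

instance {G H : SGraph} (onV : G.V → H.V) (onE : G.E → H.E) :
    Decidable (IsWeakProjection onV onE) := by
  unfold IsWeakProjection; infer_instance

/-- A computable form of covering projections. -/
def IsCoveringProjection {G H : SGraph} (onV : G.V → H.V) (onE : G.E → H.E) : Prop :=
  IsWeakProjection onV onE ∧ (∀ e, G.IsSemi e → H.IsSemi (onE e)) ∧
    ∀ e, G.IsLoop e → H.IsLoop (onE e)

instance {G H : SGraph} (onV : G.V → H.V) (onE : G.E → H.E) :
    Decidable (IsCoveringProjection onV onE) := by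
  unfold IsCoveringProjection; infer_instance

theorem Node.covers_of {G : SGraph} {b : Node} (onV : G.V → b.graph.V) (onE : G.E → b.graph.E)
    (h' : decide (IsCoveringProjection onV onE) = true) : G.Covers b.graph :=
  have h := of_decide_eq_true h'
  ⟨b.graph_connected, ⟨WeakProjection.toCovering ⟨onV, onE, h.1.1, h.1.2.1, h.1.2.2⟩ h.2.1 h.2.2⟩⟩

theorem Node.stronger_of {G : SGraph} {b : Node} (onV : G.V → b.graph.V) (onE : G.E → b.graph.E)
    (h' : decide (IsWeakProjection onV onE) = true) : G.Stronger b.graph :=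
  have h := of_decide_eq_true h'
  stronger_of_weakProjection b.graph_connected ⟨onV, onE, h.1, h.2.1, h.2.2⟩

theorem K4_covers_W10201 : Node.K4.graph.Covers Node.W10201.graph :=
  Node.covers_of (![0, 0, 1, 1] : Fin 4 → Fin 2)
    (![.inl (.inl 0), .inr (.inl 0), .inr (.inl 1), .inr (.inl 1), .inr (.inl 0), .inr (.inr (.inr
      0))] : Fin 6 → (Fin 1 ⊕ Fin 0) ⊕ Fin 2 ⊕ Fin 0 ⊕ Fin 1)
    (by decide +kernel)

theorem SG_covers_W01110 : Node.SG.graph.Covers Node.W01110.graph :=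
  Node.covers_of (![0, 1, 1, 0] : Fin 4 → Fin 2)
    (![.inl (.inr 0), .inr (.inl 0), .inr (.inr (.inl 0)), .inr (.inr (.inl 0)), .inr (.inl 0),
      .inl (.inr 0)] : Fin 6 → (Fin 0 ⊕ Fin 1) ⊕ Fin 1 ⊕ Fin 1 ⊕ Fin 0)
    (by decide +kernel)

theorem SG_covers_W01102 : Node.SG.graph.Covers Node.W01102.graph :=
  Node.covers_of (![0, 1, 1, 0] : Fin 4 → Fin 2)
    (![.inl (.inr 0), .inr (.inl 0), .inr (.inr (.inr 0)), .inr (.inr (.inr 1)), .inr (.inl 0),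
      .inl (.inr 0)] : Fin 6 → (Fin 0 ⊕ Fin 1) ⊕ Fin 1 ⊕ Fin 0 ⊕ Fin 2)
    (by decide +kernel)

theorem DG_covers_W00300 : Node.DG.graph.Covers Node.W00300.graph :=
  Node.covers_of (![0, 1, 0, 1] : Fin 4 → Fin 2)
    (![.inr (.inl 0), .inr (.inl 1), .inr (.inl 2), .inr (.inl 0), .inr (.inl 1), .inr (.inl 2)] :
      Fin 6 → (Fin 0 ⊕ Fin 0) ⊕ Fin 3 ⊕ Fin 0 ⊕ Fin 0)
    (by decide +kernel)

theorem DG_covers_W01110 : Node.DG.graph.Covers Node.W01110.graph :=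
  Node.covers_of (![0, 0, 1, 1] : Fin 4 → Fin 2)
    (![.inl (.inr 0), .inl (.inr 0), .inr (.inl 0), .inr (.inr (.inl 0)), .inr (.inr (.inl 0)),
      .inr (.inl 0)] : Fin 6 → (Fin 0 ⊕ Fin 1) ⊕ Fin 1 ⊕ Fin 1 ⊕ Fin 0)
    (by decide +kernel)

theorem DG_covers_W10201 : Node.DG.graph.Covers Node.W10201.graph :=
  Node.covers_of (![0, 1, 1, 0] : Fin 4 → Fin 2)
    (![.inr (.inl 0), .inr (.inl 1), .inr (.inr (.inr 0)), .inr (.inl 0), .inr (.inl 1), .inl (.inl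
      0)] : Fin 6 → (Fin 1 ⊕ Fin 0) ⊕ Fin 2 ⊕ Fin 0 ⊕ Fin 1)
    (by decide +kernel)

theorem DG_covers_W01102 : Node.DG.graph.Covers Node.W01102.graph :=
  Node.covers_of (![0, 0, 1, 1] : Fin 4 → Fin 2)
    (![.inl (.inr 0), .inl (.inr 0), .inr (.inl 0), .inr (.inr (.inr 0)), .inr (.inr (.inr 1)),
      .inr (.inl 0)] : Fin 6 → (Fin 0 ⊕ Fin 1) ⊕ Fin 1 ⊕ Fin 0 ⊕ Fin 2)
    (by decide +kernel)

theorem DG_covers_W20102 : Node.DG.graph.Covers Node.W20102.graph :=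
  Node.covers_of (![0, 0, 1, 1] : Fin 4 → Fin 2)
    (![.inl (.inl 0), .inl (.inl 1), .inr (.inl 0), .inr (.inr (.inr 0)), .inr (.inr (.inr 1)),
      .inr (.inl 0)] : Fin 6 → (Fin 2 ⊕ Fin 0) ⊕ Fin 1 ⊕ Fin 0 ⊕ Fin 2)
    (by decide +kernel)

theorem WG_covers_F11 : Node.WG.graph.Covers Node.F11.graph :=
  Node.covers_of (![0, 0, 0, 0] : Fin 4 → Fin 1)
    (![.inr 0, .inl 0, .inr 0, .inr 0, .inl 0, .inr 0] : Fin 6 → Fin 1 ⊕ Fin 1)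
    (by decide +kernel)

theorem W00300_covers_F30 : Node.W00300.graph.Covers Node.F30.graph :=
  Node.covers_of (![0, 0] : Fin 2 → Fin 1)
    (Sum.elim (Sum.elim (![] : Fin 0 → Fin 3 ⊕ Fin 0) (![] : Fin 0 → Fin 3 ⊕ Fin 0))
      (Sum.elim (![.inl 0, .inl 1, .inl 2] : Fin 3 → Fin 3 ⊕ Fin 0) (Sum.elim (![] : Fin 0 → Fin 3
        ⊕ Fin 0) (![] : Fin 0 → Fin 3 ⊕ Fin 0))) : (Fin 0 ⊕ Fin 0) ⊕ Fin 3 ⊕ Fin 0 ⊕ Fin 0 → Fin 3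
        ⊕ Fin 0)
    (by decide +kernel)

theorem W00300_covers_F11 : Node.W00300.graph.Covers Node.F11.graph :=
  Node.covers_of (![0, 0] : Fin 2 → Fin 1)
    (Sum.elim (Sum.elim (![] : Fin 0 → Fin 1 ⊕ Fin 1) (![] : Fin 0 → Fin 1 ⊕ Fin 1))
      (Sum.elim (![.inl 0, .inr 0, .inr 0] : Fin 3 → Fin 1 ⊕ Fin 1) (Sum.elim (![] : Fin 0 → Fin 1
        ⊕ Fin 1) (![] : Fin 0 → Fin 1 ⊕ Fin 1))) : (Fin 0 ⊕ Fin 0) ⊕ Fin 3 ⊕ Fin 0 ⊕ Fin 0 → Fin 1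
        ⊕ Fin 1)
    (by decide +kernel)

theorem W01110_covers_F11 : Node.W01110.graph.Covers Node.F11.graph :=
  Node.covers_of (![0, 0] : Fin 2 → Fin 1)
    (Sum.elim (Sum.elim (![] : Fin 0 → Fin 1 ⊕ Fin 1) (![.inr 0] : Fin 1 → Fin 1 ⊕ Fin 1))
      (Sum.elim (![.inl 0] : Fin 1 → Fin 1 ⊕ Fin 1) (Sum.elim (![.inr 0] : Fin 1 → Fin 1 ⊕ Fin 1)
        (![] : Fin 0 → Fin 1 ⊕ Fin 1))) : (Fin 0 ⊕ Fin 1) ⊕ Fin 1 ⊕ Fin 1 ⊕ Fin 0 → Fin 1 ⊕ Fin 1)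
    (by decide +kernel)

theorem W10201_covers_F30 : Node.W10201.graph.Covers Node.F30.graph :=
  Node.covers_of (![0, 0] : Fin 2 → Fin 1)
    (Sum.elim (Sum.elim (![.inl 0] : Fin 1 → Fin 3 ⊕ Fin 0) (![] : Fin 0 → Fin 3 ⊕ Fin 0))
      (Sum.elim (![.inl 1, .inl 2] : Fin 2 → Fin 3 ⊕ Fin 0) (Sum.elim (![] : Fin 0 → Fin 3 ⊕ Fin 0)
        (![.inl 0] : Fin 1 → Fin 3 ⊕ Fin 0))) : (Fin 1 ⊕ Fin 0) ⊕ Fin 2 ⊕ Fin 0 ⊕ Fin 1 → Fin 3 ⊕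
        Fin 0)
    (by decide +kernel)

theorem W10201_covers_F11 : Node.W10201.graph.Covers Node.F11.graph :=
  Node.covers_of (![0, 0] : Fin 2 → Fin 1)
    (Sum.elim (Sum.elim (![.inl 0] : Fin 1 → Fin 1 ⊕ Fin 1) (![] : Fin 0 → Fin 1 ⊕ Fin 1))
      (Sum.elim (![.inr 0, .inr 0] : Fin 2 → Fin 1 ⊕ Fin 1) (Sum.elim (![] : Fin 0 → Fin 1 ⊕ Fin 1)
        (![.inl 0] : Fin 1 → Fin 1 ⊕ Fin 1))) : (Fin 1 ⊕ Fin 0) ⊕ Fin 2 ⊕ Fin 0 ⊕ Fin 1 → Fin 1 ⊕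
        Fin 1)
    (by decide +kernel)

theorem W20102_covers_F30 : Node.W20102.graph.Covers Node.F30.graph :=
  Node.covers_of (![0, 0] : Fin 2 → Fin 1)
    (Sum.elim (Sum.elim (![.inl 0, .inl 1] : Fin 2 → Fin 3 ⊕ Fin 0) (![] : Fin 0 → Fin 3 ⊕ Fin 0))
      (Sum.elim (![.inl 2] : Fin 1 → Fin 3 ⊕ Fin 0) (Sum.elim (![] : Fin 0 → Fin 3 ⊕ Fin 0) (![.inl
        0, .inl 1] : Fin 2 → Fin 3 ⊕ Fin 0))) : (Fin 2 ⊕ Fin 0) ⊕ Fin 1 ⊕ Fin 0 ⊕ Fin 2 → Fin 3 ⊕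
        Fin 0)
    (by decide +kernel)

theorem W20102_stronger_W01102 : Node.W20102.graph.Stronger Node.W01102.graph :=
  Node.stronger_of (![0, 1] : Fin 2 → Fin 2)
    (Sum.elim (Sum.elim (![.inl (.inr 0), .inl (.inr 0)] : Fin 2 → (Fin 0 ⊕ Fin 1) ⊕ Fin 1 ⊕ Fin 0
      ⊕ Fin 2) (![] : Fin 0 → (Fin 0 ⊕ Fin 1) ⊕ Fin 1 ⊕ Fin 0 ⊕ Fin 2))
      (Sum.elim (![.inr (.inl 0)] : Fin 1 → (Fin 0 ⊕ Fin 1) ⊕ Fin 1 ⊕ Fin 0 ⊕ Fin 2) (Sum.elim (![]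
        : Fin 0 → (Fin 0 ⊕ Fin 1) ⊕ Fin 1 ⊕ Fin 0 ⊕ Fin 2) (![.inr (.inr (.inr 0)), .inr (.inr
        (.inr 1))] : Fin 2 → (Fin 0 ⊕ Fin 1) ⊕ Fin 1 ⊕ Fin 0 ⊕ Fin 2))) : (Fin 2 ⊕ Fin 0) ⊕ Fin 1 ⊕
        Fin 0 ⊕ Fin 2 → (Fin 0 ⊕ Fin 1) ⊕ Fin 1 ⊕ Fin 0 ⊕ Fin 2)
    (by decide +kernel)

theorem W01102_stronger_W01110 : Node.W01102.graph.Stronger Node.W01110.graph :=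
  Node.stronger_of (![0, 1] : Fin 2 → Fin 2)
    (Sum.elim (Sum.elim (![] : Fin 0 → (Fin 0 ⊕ Fin 1) ⊕ Fin 1 ⊕ Fin 1 ⊕ Fin 0) (![.inl (.inr 0)] :
      Fin 1 → (Fin 0 ⊕ Fin 1) ⊕ Fin 1 ⊕ Fin 1 ⊕ Fin 0))
      (Sum.elim (![.inr (.inl 0)] : Fin 1 → (Fin 0 ⊕ Fin 1) ⊕ Fin 1 ⊕ Fin 1 ⊕ Fin 0) (Sum.elim (![]
        : Fin 0 → (Fin 0 ⊕ Fin 1) ⊕ Fin 1 ⊕ Fin 1 ⊕ Fin 0) (![.inr (.inr (.inl 0)), .inr (.inr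
        (.inl 0))] : Fin 2 → (Fin 0 ⊕ Fin 1) ⊕ Fin 1 ⊕ Fin 1 ⊕ Fin 0))) : (Fin 0 ⊕ Fin 1) ⊕ Fin 1 ⊕
        Fin 0 ⊕ Fin 2 → (Fin 0 ⊕ Fin 1) ⊕ Fin 1 ⊕ Fin 1 ⊕ Fin 0)
    (by decide +kernel)

theorem F30_stronger_F11 : Node.F30.graph.Stronger Node.F11.graph :=
  Node.stronger_of (![0] : Fin 1 → Fin 1)
    (Sum.elim (![.inl 0, .inr 0, .inr 0] : Fin 3 → Fin 1 ⊕ Fin 1) (![] : Fin 0 → Fin 1 ⊕ Fin 1) :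
      Fin 3 ⊕ Fin 0 → Fin 1 ⊕ Fin 1)
    (by decide +kernel)

/-! ### Negative arrows -/

theorem Node.not_stronger_of_not_covers {a b : Node} {G : SGraph} (hG : G.IsSimple)
    (ha : G.Covers a.graph) (hb : ¬ G.Covers b.graph) : ¬ a.graph.Stronger b.graph :=
  fun h => hb (h G hG ha)

/-- The data of a constraint satisfaction problem that a covering projection from `G` to `H`
solves. -/
def IsConstraint {G H : SGraph} {m : ℕ} (col : H.V ≃ Fin m) (M : Fin m → Fin m → ℕ)
    (ord : ℕ → G.V) (cons : List (ℕ × List (G.E × ℕ))) : Prop :=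
  (∀ x w, H.adj x w ≤ M (col x) (col w)) ∧
    ∀ c ∈ cons, (c.2.map Prod.fst).Nodup ∧ ∀ a ∈ c.2, G.ends a.1 = s(ord c.1, ord a.2)

instance {G H : SGraph} {m : ℕ} (col : H.V ≃ Fin m) (M : Fin m → Fin m → ℕ)
    (ord : ℕ → G.V) (cons : List (ℕ × List (G.E × ℕ))) :
    Decidable (IsConstraint col M ord cons) := by
  unfold IsConstraint; infer_instance

/-- A covering projection colours the vertices of `G` by those of `H`, subject to the bounds `M`.
Vertices enter the search as positions in the order `ord`, and an unsatisfiable part of the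
constraints is enough. -/
theorem not_covers_of_refute {G H : SGraph} {m : ℕ} (col : H.V ≃ Fin m)
    (M : Fin m → Fin m → ℕ) (ord : ℕ → G.V) (cons : List (ℕ × List (G.E × ℕ)))
    (h' : decide (IsConstraint col M ord cons) = true) (n : ℕ)
    (hr : refute M (cons.map fun c => (c.1, c.2.map Prod.snd)) n [] = true) : ¬ G.Covers H := by
  rintro ⟨_, ⟨p⟩⟩
  have h := of_decide_eq_true h'
  refine absurd (refute_eq_false (M := M) (fun i => col (p.onV (ord i))) ?_ n 0)
    (by simpa using hr)
  intro c hc w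
  obtain ⟨c, hc', rfl⟩ := List.mem_map.1 hc
  obtain ⟨w, rfl⟩ := col.surjective w
  refine le_trans ?_ (h.1 _ _)
  have h1 := p.toWeak.card_le_adj (ord c.1) w (c.2.map fun a => (a.1, ord a.2))
    (by simpa [List.map_map, Function.comp_def] using (h.2 c hc').1)
    (fun a ha => by
      obtain ⟨a, ha', rfl⟩ := List.mem_map.1 ha
      exact (h.2 c hc').2 a ha')
  refine le_trans (le_of_eq ?_) h1
  rw [List.countP_map, List.countP_map]
  refine List.countP_congr fun a _ => ?_
  simp only [CoveringProjection.toWeak, Function.comp, EmbeddingLike.apply_eq_iff_eq,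
    decide_eq_true_eq]
  exact decide_eq_true_iff.symm

/-- The preimages of the three semi-edges are disjoint perfect matchings. One that avoids `e₀`, the
only edge that may leave `X`, would match the odd set `X` within itself. -/
theorem not_covers_F30_of_cut {G : SGraph} (hG : G.SemiEdgeFree) (s t : G.E → G.V)
    (hst : ∀ e, G.ends e = s(s e, t e)) (X : G.V → Bool) (e₀ : G.E)
    (h' : decide (¬ Even (Finset.card {v | X v = true}) ∧
      ∀ e, e ≠ e₀ → X (s e) = X (t e)) = true) : ¬ G.Covers (F 3 0) := by
  rintro ⟨_, ⟨p⟩⟩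
  obtain ⟨hX, hcut⟩ := of_decide_eq_true h'
  obtain ⟨i, hi⟩ : ∃ i : Fin 3, p.onE e₀ ≠ (Sum.inl i : Fin 3 ⊕ Fin 0) := by
    by_contra! h
    exact absurd (Sum.inl.inj ((h 0).symm.trans (h 1))) (by decide)
  refine hX (p.toWeak.even_card_of_isSemi hG (f := (Sum.inl i : Fin 3 ⊕ Fin 0)) rfl _
    (fun v _ => ?_) fun e he u v huv => ?_)
  · rw [show p.toWeak.onV v = (0 : Fin 1) from Subsingleton.elim (α := Fin 1) _ _]
    exact Sym2.mem_mk_left (0 : Fin 1) 0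
  · have := hcut e (fun h => hi (h ▸ he))
    rw [hst, Sym2.eq_iff] at huv
    rcases huv with ⟨rfl, rfl⟩ | ⟨rfl, rfl⟩ <;> simp [this]

/-- The preimage of the semi-edge is a perfect matching. By parity it contains both edges `e₀ j`,
each being the only edge that may leave an odd set; but they are distinct and share the vertex `c`.
-/
theorem not_covers_F11_of_cut {G : SGraph} (hG : G.SemiEdgeFree) (s t : G.E → G.V)
    (hst : ∀ e, G.ends e = s(s e, t e)) (X : Fin 2 → G.V → Bool) (e₀ : Fin 2 → G.E) (c : G.V)
    (h' : decide ((∀ j, ¬ Even (Finset.card {v | X j v = true}) ∧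
      ∀ e, e ≠ e₀ j → X j (s e) = X j (t e)) ∧
      (∀ j, c ∈ G.ends (e₀ j)) ∧ e₀ 0 ≠ e₀ 1) = true) : ¬ G.Covers (F 1 1) := by
  rintro ⟨_, ⟨p⟩⟩
  obtain ⟨hX, hc, hne⟩ := of_decide_eq_true h'
  have hV : ∀ v, p.onV v = (0 : Fin 1) := fun v => Subsingleton.elim (α := Fin 1) _ _
  obtain ⟨f, hf⟩ : ∃ f : (F 1 1).E, (F 1 1).IsSemi f := ⟨Sum.inl (0 : Fin 1), rfl⟩
  have key : ∀ j, p.onE (e₀ j) = f := by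
    intro j
    by_contra hi
    refine (hX j).1 (p.toWeak.even_card_of_isSemi hG hf _
      (fun v _ => ?_) fun e he u v huv => ?_)
    · rw [show p.toWeak.onV v = (0 : Fin 1) from hV v]
      exact Sym2.mem_mk_left (0 : Fin 1) 0
    · have := (hX j).2 e (fun h => hi (h ▸ he))
      rw [hst, Sym2.eq_iff] at huv
      rcases huv with ⟨rfl, rfl⟩ | ⟨rfl, rfl⟩ <;> simp [this]
  have h1 := p.toWeak.sum_mult c f
  rw [show p.toWeak.onV c = (0 : Fin 1) from hV c] at h1
  have h2 : (F 1 1).mult (0 : Fin 1) f = 1 :=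
    mult_eq_one_of_isSemi (Sym2.mem_mk_left (0 : Fin 1) 0) hf
  have h3 : ∑ e ∈ {e₀ 0, e₀ 1}, G.mult c e ≤
      ∑ e with p.toWeak.onE e = f, G.mult c e := by
    refine Finset.sum_le_sum_of_subset fun e he => ?_
    rcases Finset.mem_insert.1 he with rfl | he
    · exact Finset.mem_filter.2 ⟨Finset.mem_univ _, key 0⟩
    · rw [Finset.mem_singleton.1 he]
      exact Finset.mem_filter.2 ⟨Finset.mem_univ _, key 1⟩
  rw [h1, Finset.sum_pair hne] at h3
  have h4 := mult_pos (hc 0)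
  have h5 := mult_pos (hc 1)
  omega

/-- The hypotheses of `lift_isSimple` in a computable form. -/
def IsSimpleLift {A : SGraph} {ι : Type} [Fintype ι] [DecidableEq ι] (s t : A.E → A.V)
    (σ : A.E → Equiv.Perm ι) : Prop :=
  (∀ e e', s(s e, t e) = s(s e', t e') → s e = s e' ∧ t e = t e') ∧
    (∀ e, s e = t e → ∀ i, σ e i ≠ i ∧ σ e (σ e i) ≠ i) ∧
    ∀ e e', e ≠ e' → s e = s e' → t e = t e' → s e ≠ t e ∧ ∀ i, σ e i ≠ σ e' i

instance {A : SGraph} {ι : Type} [Fintype ι] [DecidableEq ι] (s t : A.E → A.V)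
    (σ : A.E → Equiv.Perm ι) : Decidable (IsSimpleLift s t σ) := by
  unfold IsSimpleLift; infer_instance

theorem isSimple_of_isSimpleLift {A : SGraph} {ι : Type} [Fintype ι] [DecidableEq ι]
    {s t : A.E → A.V} {σ : A.E → Equiv.Perm ι} (h' : decide (IsSimpleLift s t σ) = true) :
    (A.lift s t σ).IsSimple :=
  have h := of_decide_eq_true h'
  lift_isSimple h.1 h.2.1 h.2.2

/-- The loop lifts to the triangles 0 4 5 and 1 2 3, while over the other three vertices only the
sheets 0 1, 2 3 and 4 5 are joined. Hence the edge from (0, 0) to (1, 0) is a bridge, with the 15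
vertices other than (0, 0) of the sheets 0 to 3 on one side. -/
def permutationsWG : Fin 6 → Equiv.Perm (Fin 6) :=
  ![⟨![4, 2, 3, 1, 5, 0], ![5, 3, 1, 2, 0, 4], by decide +kernel, by decide +kernel⟩,
    1,
    1,
    1,
    1,
    ⟨![1, 0, 3, 2, 5, 4], ![1, 0, 3, 2, 5, 4], by decide +kernel, by decide +kernel⟩]

/-- A lift of `WG` with a bridge. -/
def bridgedWG : SGraph := Node.WG.graph.lift voltWG.src voltWG.tgt permutationsWG

theorem bridgedWG_isSimple : bridgedWG.IsSimple := isSimple_of_isSimpleLift (by decide +kernel)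

theorem bridgedWG_covers : bridgedWG.Covers Node.WG.graph :=
  lift_covers voltWG.semiEdgeFree Node.WG.graph_connected voltWG.ends_eq

theorem WG_not_stronger_W01110 : ¬ Node.WG.graph.Stronger Node.W01110.graph :=
  Node.not_stronger_of_not_covers bridgedWG_isSimple bridgedWG_covers <|
  not_covers_of_refute (G := bridgedWG) (H := Node.W01110.graph) (Equiv.refl (Fin 2))
    ![![2, 1], ![1, 2]]
    -- Positions beyond the end of this list occur in no constraint, so the default vertex plays no
    -- role.
    (fun i => ([(2, 3), (1, 3), (3, 3), (3, 2), (0, 3), (2, 2), (1, 2), (0, 2)] : List (Fin 4 × Fin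
      6)).getD i (0, 0))
    ([(0, [((2, 3), 1), ((4, 3), 2), ((5, 3), 3)]),
      (1, [((1, 3), 4), ((2, 3), 0), ((3, 3), 2)]),
      (2, [((3, 3), 1), ((4, 3), 0), ((5, 2), 5)]),
      (3, [((3, 2), 6), ((4, 2), 5), ((5, 3), 0)]),
      (4, [((0, 2), 7), ((1, 3), 1)]),
      (5, [((2, 2), 6), ((4, 2), 3), ((5, 2), 2)]),
      (6, [((1, 2), 7), ((2, 2), 5), ((3, 2), 3)]),
      (7, [((0, 2), 4), ((1, 2), 6)])] :
      List (ℕ × List ((Fin 6 × Fin 6) × ℕ)))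
    (by decide +kernel) 8 (by decide +kernel)

theorem WG_not_stronger_LC : ¬ Node.WG.graph.Stronger Node.LC.graph :=
  Node.not_stronger_of_not_covers bridgedWG_isSimple bridgedWG_covers <|
  not_covers_of_refute (G := bridgedWG) (H := Node.LC.graph) (Equiv.refl (Fin 4))
    ![![0, 1, 1, 1], ![1, 2, 0, 0], ![1, 0, 2, 0], ![1, 0, 0, 2]]
    (fun i => ([(2, 0), (1, 0), (3, 0), (3, 1), (0, 0), (2, 1)] : List (Fin 4 × Fin 6)).getD i (0,
      0))
    ([(0, [((2, 0), 1), ((4, 0), 2), ((5, 0), 3)]),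
      (1, [((1, 0), 4), ((2, 0), 0), ((3, 0), 2)]),
      (2, [((3, 0), 1), ((4, 0), 0), ((5, 1), 5)]),
      (3, [((4, 1), 5), ((5, 0), 0)]),
      (4, [((1, 0), 1)]),
      (5, [((4, 1), 3), ((5, 1), 2)])] :
      List (ℕ × List ((Fin 6 × Fin 6) × ℕ)))
    (by decide +kernel) 6 (by decide +kernel)

theorem WG_not_stronger_F30 : ¬ Node.WG.graph.Stronger Node.F30.graph :=
  Node.not_stronger_of_not_covers bridgedWG_isSimple bridgedWG_covers <|
  not_covers_F30_of_cut lift_semiEdgeFree _ _ (fun _ => rfl)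
    (fun v : Fin 4 × Fin 6 => v.2 ≤ 3 && (v.1 != 0 || v.2 != 0)) ((1, 0) : Fin 6 × Fin 6)
    (by decide +kernel)

/-- The loop at vertex 0 lifts to the 4-cycle 0 4 5 6 and the triangle 1 2 3; elsewhere the sheets 0
to 3 are separate from 4 to 6. Again the edge from (0, 0) to (1, 0) is a bridge with 15 vertices on
one side. -/
def permutationsSG : Fin 6 → Equiv.Perm (Fin 7) :=
  ![⟨![4, 2, 3, 1, 5, 6, 0], ![6, 3, 1, 2, 0, 4, 5], by decide +kernel, by decide +kernel⟩,
    1,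
    1,
    ⟨![1, 2, 3, 0, 5, 6, 4], ![3, 0, 1, 2, 6, 4, 5], by decide +kernel, by decide +kernel⟩,
    1,
    ⟨![1, 2, 3, 0, 5, 6, 4], ![3, 0, 1, 2, 6, 4, 5], by decide +kernel, by decide +kernel⟩]

/-- A lift of `SG` with a bridge. -/
def bridgedSG : SGraph := Node.SG.graph.lift voltSG.src voltSG.tgt permutationsSG

theorem bridgedSG_isSimple : bridgedSG.IsSimple := isSimple_of_isSimpleLift (by decide +kernel)

theorem bridgedSG_covers : bridgedSG.Covers Node.SG.graph :=
  lift_covers voltSG.semiEdgeFree Node.SG.graph_connected voltSG.ends_eq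

theorem SG_not_stronger_WG : ¬ Node.SG.graph.Stronger Node.WG.graph :=
  Node.not_stronger_of_not_covers bridgedSG_isSimple bridgedSG_covers <|
  not_covers_of_refute (G := bridgedSG) (H := Node.WG.graph) (Equiv.refl (Fin 4))
    ![![2, 1, 0, 0], ![1, 0, 1, 1], ![0, 1, 0, 2], ![0, 1, 2, 0]]
    (fun i => ([(0, 2), (0, 1), (0, 3), (1, 2), (1, 1), (1, 3), (2, 2), (2, 3)] : List (Fin 4 × Fin
      7)).getD i (0, 0))
    ([(0, [((0, 1), 1), ((0, 2), 2), ((1, 2), 3)]),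
      (1, [((0, 1), 0), ((0, 3), 2), ((1, 1), 4)]),
      (2, [((0, 2), 0), ((0, 3), 1), ((1, 3), 5)]),
      (3, [((1, 2), 0), ((2, 2), 6), ((3, 2), 7)]),
      (4, [((1, 1), 1), ((3, 1), 6)]),
      (5, [((1, 3), 2), ((2, 3), 7)]),
      (6, [((2, 2), 3), ((3, 1), 4)]),
      (7, [((2, 3), 5), ((3, 2), 3)])] :
      List (ℕ × List ((Fin 6 × Fin 7) × ℕ)))
    (by decide +kernel) 8 (by decide +kernel)

theorem SG_not_stronger_LC : ¬ Node.SG.graph.Stronger Node.LC.graph :=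
  Node.not_stronger_of_not_covers bridgedSG_isSimple bridgedSG_covers <|
  not_covers_of_refute (G := bridgedSG) (H := Node.LC.graph) (Equiv.refl (Fin 4))
    ![![0, 1, 1, 1], ![1, 2, 0, 0], ![1, 0, 2, 0], ![1, 0, 0, 2]]
    (fun i => ([(0, 2), (0, 1), (0, 3), (1, 2), (1, 1), (1, 3), (2, 2)] : List (Fin 4 × Fin
      7)).getD i (0, 0))
    ([(0, [((0, 1), 1), ((0, 2), 2), ((1, 2), 3)]),
      (1, [((0, 1), 0), ((0, 3), 2), ((1, 1), 4)]),
      (2, [((0, 2), 0), ((0, 3), 1), ((1, 3), 5)]),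
      (3, [((1, 2), 0), ((2, 2), 6)]),
      (4, [((1, 1), 1), ((3, 1), 6)]),
      (5, [((1, 3), 2)]),
      (6, [((2, 2), 3), ((3, 1), 4)])] :
      List (ℕ × List ((Fin 6 × Fin 7) × ℕ)))
    (by decide +kernel) 7 (by decide +kernel)

theorem SG_not_stronger_F30 : ¬ Node.SG.graph.Stronger Node.F30.graph :=
  Node.not_stronger_of_not_covers bridgedSG_isSimple bridgedSG_covers <|
  not_covers_F30_of_cut lift_semiEdgeFree _ _ (fun _ => rfl)
    (fun v : Fin 4 × Fin 7 => v.2 ≤ 3 && (v.1 != 0 || v.2 != 0)) ((1, 0) : Fin 6 × Fin 7)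
    (by decide +kernel)

/-- Removing the vertex (0, 0) leaves three components of 13 vertices: the sheets 1 to 3, 4 to 6 and
7 to 9, each with one of the neighbours (1, 0), (2, 0), (3, 0), which its loop joins to that block.
Hence there is no perfect matching. -/
def permutationsLC : Fin 6 → Equiv.Perm (Fin 10) :=
  ![1,
    1,
    1,
    ⟨![1, 2, 3, 0, 5, 6, 4, 8, 9, 7], ![3, 0, 1, 2, 6, 4, 5, 9, 7, 8], by decide +kernel,
      by decide +kernel⟩,
    ⟨![4, 2, 3, 1, 5, 6, 0, 8, 9, 7], ![6, 3, 1, 2, 0, 4, 5, 9, 7, 8], by decide +kernel,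
      by decide +kernel⟩,
    ⟨![7, 2, 3, 1, 5, 6, 4, 8, 9, 0], ![9, 3, 1, 2, 6, 4, 5, 0, 7, 8], by decide +kernel,
      by decide +kernel⟩]

/-- A lift of `LC` with a bridge. -/
def bridgedLC : SGraph := Node.LC.graph.lift voltLC.src voltLC.tgt permutationsLC

theorem bridgedLC_isSimple : bridgedLC.IsSimple := isSimple_of_isSimpleLift (by decide +kernel)

theorem bridgedLC_covers : bridgedLC.Covers Node.LC.graph :=
  lift_covers voltLC.semiEdgeFree Node.LC.graph_connected voltLC.ends_eq

theorem LC_not_stronger_F11 : ¬ Node.LC.graph.Stronger Node.F11.graph :=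
  Node.not_stronger_of_not_covers bridgedLC_isSimple bridgedLC_covers <|
  not_covers_F11_of_cut lift_semiEdgeFree _ _ (fun _ => rfl)
    (![fun v => (1 ≤ v.2 && v.2 ≤ 3) || (v.1 == 1 && v.2 == 0),
      fun v => (4 ≤ v.2 && v.2 ≤ 6) || (v.1 == 2 && v.2 == 0)] : Fin 2 → Fin 4 × Fin 10 → Bool)
    (![(0, 0), (1, 0)] : Fin 2 → Fin 6 × Fin 10) ((0, 0) : Fin 4 × Fin 10) (by decide +kernel)

/-- Being simple, `K4` serves as its own test graph. -/
theorem K4_isSimple : Node.K4.graph.IsSimple :=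
  ⟨by decide +kernel, by decide +kernel, by decide +kernel⟩

theorem K4_not_stronger_W00300 : ¬ Node.K4.graph.Stronger Node.W00300.graph :=
  Node.not_stronger_of_not_covers K4_isSimple (Covers.refl Node.K4.graph_connected) <|
  not_covers_of_refute (G := Node.K4.graph) (H := Node.W00300.graph) (Equiv.refl (Fin 2))
    ![![0, 3], ![3, 0]]
    (fun i => ([0, 1, 2] : List (Fin 4)).getD i 0)
    ([(0, [(0, 1), (1, 2)]),
      (1, [(0, 0), (3, 2)]),
      (2, [(1, 0), (3, 1)])] :
      List (ℕ × List ((Fin 6) × ℕ)))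
    (by decide +kernel) 3 (by decide +kernel)

theorem K4_not_stronger_W01110 : ¬ Node.K4.graph.Stronger Node.W01110.graph :=
  Node.not_stronger_of_not_covers K4_isSimple (Covers.refl Node.K4.graph_connected) <|
  not_covers_of_refute (G := Node.K4.graph) (H := Node.W01110.graph) (Equiv.refl (Fin 2))
    ![![2, 1], ![1, 2]]
    (fun i => ([0, 1, 2, 3] : List (Fin 4)).getD i 0)
    ([(0, [(0, 1), (1, 2), (2, 3)]),
      (1, [(0, 0), (3, 2), (4, 3)]),
      (2, [(1, 0), (3, 1), (5, 3)]),
      (3, [(2, 0), (4, 1), (5, 2)])] :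
      List (ℕ × List ((Fin 6) × ℕ)))
    (by decide +kernel) 4 (by decide +kernel)

theorem K4_not_stronger_WG : ¬ Node.K4.graph.Stronger Node.WG.graph :=
  Node.not_stronger_of_not_covers K4_isSimple (Covers.refl Node.K4.graph_connected) <|
  not_covers_of_refute (G := Node.K4.graph) (H := Node.WG.graph) (Equiv.refl (Fin 4))
    ![![2, 1, 0, 0], ![1, 0, 1, 1], ![0, 1, 0, 2], ![0, 1, 2, 0]]
    (fun i => ([0, 1, 2, 3] : List (Fin 4)).getD i 0)
    ([(0, [(0, 1), (1, 2), (2, 3)]),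
      (1, [(0, 0), (3, 2), (4, 3)]),
      (2, [(1, 0), (3, 1), (5, 3)]),
      (3, [(2, 0), (4, 1), (5, 2)])] :
      List (ℕ × List ((Fin 6) × ℕ)))
    (by decide +kernel) 4 (by decide +kernel)

theorem K4_not_stronger_LC : ¬ Node.K4.graph.Stronger Node.LC.graph :=
  Node.not_stronger_of_not_covers K4_isSimple (Covers.refl Node.K4.graph_connected) <|
  not_covers_of_refute (G := Node.K4.graph) (H := Node.LC.graph) (Equiv.refl (Fin 4))
    ![![0, 1, 1, 1], ![1, 2, 0, 0], ![1, 0, 2, 0], ![1, 0, 0, 2]]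
    (fun i => ([0, 1, 2, 3] : List (Fin 4)).getD i 0)
    ([(0, [(0, 1), (1, 2), (2, 3)]),
      (1, [(0, 0), (3, 2), (4, 3)]),
      (2, [(1, 0), (3, 1), (5, 3)]),
      (3, [(2, 0), (4, 1), (5, 2)])] :
      List (ℕ × List ((Fin 6) × ℕ)))
    (by decide +kernel) 4 (by decide +kernel)

theorem DG_not_stronger_K4 : ¬ Node.DG.graph.Stronger Node.K4.graph :=
  Node.not_stronger_of_not_covers (voltDG.lift_isSimple 3 (by norm_num)) (voltDG.lift_covers 3
    Node.DG.graph_connected) <|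
  not_covers_of_refute (G := voltDG.lift 3) (H := Node.K4.graph) (Equiv.refl (Fin 4))
    ![![0, 1, 1, 1], ![1, 0, 1, 1], ![1, 1, 0, 1], ![1, 1, 1, 0]]
    (fun i => ([(0, 0), (1, 0), (1, 1), (3, 0), (0, 2), (2, 0), (0, 1), (2, 1), (2, 2), (1, 2)] :
      List (Fin 4 × Fin 3)).getD i (0, 0))
    ([(0, [((0, 0), 1), ((1, 0), 2), ((5, 0), 3)]),
      (1, [((0, 0), 0), ((1, 2), 4), ((2, 0), 5)]),
      (2, [((0, 1), 6), ((1, 0), 0), ((2, 1), 7)]),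
      (3, [((3, 0), 5), ((4, 2), 8), ((5, 0), 0)]),
      (4, [((0, 2), 9), ((1, 2), 1)]),
      (5, [((2, 0), 1), ((3, 0), 3)]),
      (6, [((0, 1), 2), ((1, 1), 9)]),
      (7, [((2, 1), 2)]),
      (8, [((2, 2), 9), ((4, 2), 3)]),
      (9, [((0, 2), 4), ((1, 1), 6), ((2, 2), 8)])] :
      List (ℕ × List ((Fin 6 × Fin 3) × ℕ)))
    (by decide +kernel) 10 (by decide +kernel)

theorem DG_not_stronger_SG : ¬ Node.DG.graph.Stronger Node.SG.graph :=
  Node.not_stronger_of_not_covers (voltDG.lift_isSimple 3 (by norm_num)) (voltDG.lift_covers 3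
    Node.DG.graph_connected) <|
  not_covers_of_refute (G := voltDG.lift 3) (H := Node.SG.graph) (Equiv.refl (Fin 4))
    ![![2, 1, 0, 0], ![1, 0, 2, 0], ![0, 2, 0, 1], ![0, 0, 1, 2]]
    (fun i => ([(2, 0), (1, 0), (3, 0), (3, 1), (0, 0), (0, 2), (2, 2), (2, 1), (0, 1), (1, 1), (1,
      2)] : List (Fin 4 × Fin 3)).getD i (0, 0))
    ([(0, [((2, 0), 1), ((3, 0), 2), ((4, 0), 3)]),
      (1, [((0, 0), 4), ((1, 2), 5), ((2, 0), 0)]),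
      (2, [((3, 0), 0), ((4, 2), 6), ((5, 0), 4)]),
      (3, [((3, 1), 7), ((4, 0), 0), ((5, 1), 8)]),
      (4, [((0, 0), 1), ((1, 0), 9), ((5, 0), 2)]),
      (5, [((0, 2), 10), ((1, 2), 1)]),
      (6, [((2, 2), 10), ((4, 2), 2)]),
      (7, [((2, 1), 9), ((3, 1), 3)]),
      (8, [((0, 1), 9), ((1, 1), 10), ((5, 1), 3)]),
      (9, [((0, 1), 8), ((1, 0), 4), ((2, 1), 7)]),
      (10, [((0, 2), 5), ((1, 1), 8), ((2, 2), 6)])] :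
      List (ℕ × List ((Fin 6 × Fin 3) × ℕ)))
    (by decide +kernel) 11 (by decide +kernel)

theorem DG_not_stronger_WG : ¬ Node.DG.graph.Stronger Node.WG.graph :=
  Node.not_stronger_of_not_covers (voltDG.lift_isSimple 3 (by norm_num)) (voltDG.lift_covers 3
    Node.DG.graph_connected) <|
  not_covers_of_refute (G := voltDG.lift 3) (H := Node.WG.graph) (Equiv.refl (Fin 4))
    ![![2, 1, 0, 0], ![1, 0, 1, 1], ![0, 1, 0, 2], ![0, 1, 2, 0]]
    (fun i => ([(2, 0), (1, 0), (3, 0), (3, 1), (0, 0), (0, 2), (2, 2), (2, 1), (0, 1), (1, 1)] :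
      List (Fin 4 × Fin 3)).getD i (0, 0))
    ([(0, [((2, 0), 1), ((3, 0), 2), ((4, 0), 3)]),
      (1, [((0, 0), 4), ((1, 2), 5), ((2, 0), 0)]),
      (2, [((3, 0), 0), ((4, 2), 6), ((5, 0), 4)]),
      (3, [((3, 1), 7), ((4, 0), 0), ((5, 1), 8)]),
      (4, [((0, 0), 1), ((1, 0), 9), ((5, 0), 2)]),
      (5, [((1, 2), 1)]),
      (6, [((4, 2), 2)]),
      (7, [((2, 1), 9), ((3, 1), 3)]),
      (8, [((0, 1), 9), ((5, 1), 3)]),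
      (9, [((0, 1), 8), ((1, 0), 4), ((2, 1), 7)])] :
      List (ℕ × List ((Fin 6 × Fin 3) × ℕ)))
    (by decide +kernel) 10 (by decide +kernel)

theorem DG_not_stronger_LC : ¬ Node.DG.graph.Stronger Node.LC.graph :=
  Node.not_stronger_of_not_covers (voltDG.lift_isSimple 3 (by norm_num)) (voltDG.lift_covers 3
    Node.DG.graph_connected) <|
  not_covers_of_refute (G := voltDG.lift 3) (H := Node.LC.graph) (Equiv.refl (Fin 4))
    ![![0, 1, 1, 1], ![1, 2, 0, 0], ![1, 0, 2, 0], ![1, 0, 0, 2]]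
    (fun i => ([(2, 0), (1, 0), (3, 0), (3, 1), (0, 0), (0, 2), (2, 2), (2, 1), (0, 1), (1, 1)] :
      List (Fin 4 × Fin 3)).getD i (0, 0))
    ([(0, [((2, 0), 1), ((3, 0), 2), ((4, 0), 3)]),
      (1, [((0, 0), 4), ((1, 2), 5), ((2, 0), 0)]),
      (2, [((3, 0), 0), ((4, 2), 6), ((5, 0), 4)]),
      (3, [((3, 1), 7), ((4, 0), 0), ((5, 1), 8)]),
      (4, [((0, 0), 1), ((1, 0), 9), ((5, 0), 2)]),
      (5, [((1, 2), 1)]),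
      (6, [((4, 2), 2)]),
      (7, [((2, 1), 9), ((3, 1), 3)]),
      (8, [((0, 1), 9), ((5, 1), 3)]),
      (9, [((0, 1), 8), ((1, 0), 4), ((2, 1), 7)])] :
      List (ℕ × List ((Fin 6 × Fin 3) × ℕ)))
    (by decide +kernel) 10 (by decide +kernel)

/-- With voltages 0, 1, 2 the lift with fibres of size 3 is the complete bipartite graph on 3 + 3
vertices. -/
theorem W00300_not_stronger_W01110 : ¬ Node.W00300.graph.Stronger Node.W01110.graph :=
  Node.not_stronger_of_not_covers (voltW00300.lift_isSimple 3 (by norm_num))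
    (voltW00300.lift_covers 3 Node.W00300.graph_connected) <|
  not_covers_of_refute (G := voltW00300.lift 3) (H := Node.W01110.graph) (Equiv.refl (Fin 2))
    ![![2, 1], ![1, 2]]
    (fun i => ([(0, 0), (1, 0), (1, 1), (1, 2), (0, 2)] : List (Fin 2 × Fin 3)).getD i (0, 0))
    ([(0, [((.inr (.inl 0), 0), 1), ((.inr (.inl 1), 0), 2), ((.inr (.inl 2), 0), 3)]),
      (1, [((.inr (.inl 0), 0), 0), ((.inr (.inl 1), 2), 4)]),
      (2, [((.inr (.inl 1), 0), 0), ((.inr (.inl 2), 2), 4)]),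
      (3, [((.inr (.inl 0), 2), 4), ((.inr (.inl 2), 0), 0)]),
      (4, [((.inr (.inl 0), 2), 3), ((.inr (.inl 1), 2), 1), ((.inr (.inl 2), 2), 2)])] :
      List (ℕ × List ((((Fin 0 ⊕ Fin 0) ⊕ Fin 3 ⊕ Fin 0 ⊕ Fin 0) × Fin 3) × ℕ)))
    (by decide +kernel) 5 (by decide +kernel)

theorem W00300_not_stronger_W10201 : ¬ Node.W00300.graph.Stronger Node.W10201.graph :=
  Node.not_stronger_of_not_covers (voltW00300.lift_isSimple 3 (by norm_num))
    (voltW00300.lift_covers 3 Node.W00300.graph_connected) <|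
  not_covers_of_refute (G := voltW00300.lift 3) (H := Node.W10201.graph) (Equiv.refl (Fin 2))
    ![![1, 2], ![2, 1]]
    (fun i => ([(0, 0), (1, 0), (1, 1), (1, 2), (0, 2)] : List (Fin 2 × Fin 3)).getD i (0, 0))
    ([(0, [((.inr (.inl 0), 0), 1), ((.inr (.inl 1), 0), 2), ((.inr (.inl 2), 0), 3)]),
      (1, [((.inr (.inl 0), 0), 0), ((.inr (.inl 1), 2), 4)]),
      (2, [((.inr (.inl 1), 0), 0), ((.inr (.inl 2), 2), 4)]),
      (3, [((.inr (.inl 0), 2), 4), ((.inr (.inl 2), 0), 0)]),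
      (4, [((.inr (.inl 0), 2), 3), ((.inr (.inl 1), 2), 1), ((.inr (.inl 2), 2), 2)])] :
      List (ℕ × List ((((Fin 0 ⊕ Fin 0) ⊕ Fin 3 ⊕ Fin 0 ⊕ Fin 0) × Fin 3) × ℕ)))
    (by decide +kernel) 5 (by decide +kernel)

/-- The lift is the triangular prism with 6 vertices. Its fibres over two vertices would have size
3, but a fibre over the end of a semi-edge is even. -/
theorem W01110_not_stronger_W01102 : ¬ Node.W01110.graph.Stronger Node.W01102.graph := by
  refine Node.not_stronger_of_not_covers (voltW01110.lift_isSimple 3 (by norm_num))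
    (voltW01110.lift_covers 3 Node.W01110.graph_connected) ?_
  rintro ⟨_, ⟨p⟩⟩
  have h1 := p.toWeak.card_eq Node.W01102.graph_connected (1 : Fin 2)
  have h2 := p.toWeak.even_card_fiber (voltW01110.lift_semiEdgeFree 3)
    (f := (.inr (.inr (.inr 0)) : (Fin 0 ⊕ Fin 1) ⊕ Fin 1 ⊕ Fin 0 ⊕ Fin 2)) rfl
    (x := (1 : Fin 2)) (Sym2.mem_mk_left (1 : Fin 2) 1)
  rw [voltW01110.card_lift] at h1
  have h3 : Fintype.card Node.W01110.graph.V = 2 := Fintype.card_fin 2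
  have h4 : Fintype.card Node.W01102.graph.V = 2 := Fintype.card_fin 2
  rw [h3, h4] at h1
  obtain ⟨r, hr⟩ := h2
  omega

/-- Two hexagons and a perfect matching between them. -/
def hexagons : SGraph := ofEnds (n := 12)
  ![s(0, 1), s(1, 2), s(2, 3), s(3, 4), s(4, 5), s(5, 0),
    s(6, 7), s(7, 8), s(8, 9), s(9, 10), s(10, 11), s(11, 6),
    s(0, 6), s(1, 7), s(2, 8), s(3, 10), s(4, 11), s(5, 9)]

theorem hexagons_isSimple : hexagons.IsSimple :=
  ⟨by decide +kernel, by decide +kernel, by decide +kernel⟩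

theorem hexagons_covers : hexagons.Covers Node.W20102.graph :=
  Node.covers_of (![0, 0, 0, 0, 0, 0, 1, 1, 1, 1, 1, 1] : Fin 12 → Fin 2)
    (![.inl (.inl 0), .inl (.inl 1), .inl (.inl 0), .inl (.inl 1), .inl (.inl 0), .inl (.inl 1),
      .inr (.inr (.inr 0)), .inr (.inr (.inr 1)), .inr (.inr (.inr 0)), .inr (.inr (.inr 1)), .inr
        (.inr (.inr 0)), .inr (.inr (.inr 1)),
      .inr (.inl 0), .inr (.inl 0), .inr (.inl 0), .inr (.inl 0), .inr (.inl 0), .inr (.inl 0)] :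
      Fin 18 → (Fin 2 ⊕ Fin 0) ⊕ Fin 1 ⊕ Fin 0 ⊕ Fin 2)
    (by decide +kernel)

/-- A cover of `W00300` is bipartite, whereas 4, 5, 9, 10, 11 form a 5-cycle owing to the twist in
the matching. -/
theorem W20102_not_stronger_W00300 : ¬ Node.W20102.graph.Stronger Node.W00300.graph :=
  Node.not_stronger_of_not_covers hexagons_isSimple hexagons_covers <|
  not_covers_of_refute (G := hexagons) (H := Node.W00300.graph) (Equiv.refl (Fin 2))
    ![![0, 3], ![3, 0]]
    (fun i => ([4, 3, 5, 11, 2, 10, 0, 9] : List (Fin 12)).getD i 0)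
    ([(0, [(3, 1), (4, 2), (16, 3)]),
      (1, [(2, 4), (3, 0), (15, 5)]),
      (2, [(4, 0), (5, 6), (17, 7)]),
      (3, [(10, 5), (16, 0)]),
      (4, [(2, 1)]),
      (5, [(9, 7), (10, 3), (15, 1)]),
      (6, [(5, 2)]),
      (7, [(9, 5), (17, 2)])] :
      List (ℕ × List ((Fin 18) × ℕ)))
    (by decide +kernel) 8 (by decide +kernel)

theorem W20102_not_stronger_W10201 : ¬ Node.W20102.graph.Stronger Node.W10201.graph :=
  Node.not_stronger_of_not_covers hexagons_isSimple hexagons_covers <|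
  not_covers_of_refute (G := hexagons) (H := Node.W10201.graph) (Equiv.refl (Fin 2))
    ![![1, 2], ![2, 1]]
    (fun i => ([4, 3, 5, 11, 2, 10, 0, 9, 6, 1, 8] : List (Fin 12)).getD i 0)
    ([(0, [(3, 1), (4, 2), (16, 3)]),
      (1, [(2, 4), (3, 0), (15, 5)]),
      (2, [(4, 0), (5, 6), (17, 7)]),
      (3, [(10, 5), (11, 8), (16, 0)]),
      (4, [(1, 9), (2, 1), (14, 10)]),
      (5, [(9, 7), (10, 3), (15, 1)]),
      (6, [(0, 9), (5, 2), (12, 8)]),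
      (7, [(8, 10), (9, 5), (17, 2)]),
      (8, [(11, 3), (12, 6)]),
      (9, [(0, 6), (1, 4)]),
      (10, [(8, 7), (14, 4)])] :
      List (ℕ × List ((Fin 18) × ℕ)))
    (by decide +kernel) 11 (by decide +kernel)

/-- The preimage of a loop has multiplicity 2 at `v`, and no semi-edge can contribute, since
semi-edges map to semi-edges. -/
theorem CoveringProjection.two_le_of_isLoop {G H : SGraph} (p : CoveringProjection G H) {f : H.E}
    (hf : H.IsLoop f) {v : G.V} (hv : p.onV v ∈ H.ends f) :
    2 ≤ ∑ e with ¬ G.IsSemi e, G.mult v e := by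
  have h1 := p.local_bij v f hv
  have h2 : H.mult (p.onV v) f = 2 := by unfold mult; rw [if_pos hv, if_pos hf]
  rw [h2] at h1
  rw [← h1]
  refine Finset.sum_le_sum_of_subset fun e he => Finset.mem_filter.2 ⟨Finset.mem_univ _, ?_⟩
  exact fun hs => hf.2 ((Finset.mem_filter.1 he).2 ▸ p.isSemi_onE e hs)

/-- Too few normal edges and loops of `G` meet at a vertex over the vertex of a loop of `H`. -/
def LacksLoop (G H : SGraph) : Prop :=
  ∃ f, H.IsLoop f ∧ ∃ x ∈ H.ends f,
    (∀ v, ∑ e with ¬ G.IsSemi e, G.mult v e < 2) ∨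
      (∀ y, y = x) ∧ ∃ v, ∑ e with ¬ G.IsSemi e, G.mult v e < 2

instance (G H : SGraph) : Decidable (LacksLoop G H) := by
  unfold LacksLoop; infer_instance

theorem LacksLoop.not_covers {G H : SGraph} (h : LacksLoop G H) : ¬ G.Covers H := by
  rintro ⟨_, ⟨p⟩⟩
  obtain ⟨f, hf, x, hx, h | ⟨hy, v, hv⟩⟩ := h
  · obtain ⟨v, rfl⟩ := p.surjective_onV x
    have := p.two_le_of_isLoop hf hx
    have := h v
    omega
  · have := p.two_le_of_isLoop hf (v := v) (by rwa [hy (p.onV v)])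
    omega

/-! ### The two relations on the nodes as finite tables -/

namespace Node

instance : Fintype Node :=
  Fintype.ofList [F11, F30, W00300, W01110, W10201, W01102, W20102, K4, SG, DG, WG, LC]
    (by intro x; cases x <;> decide)

/-- The targets of the green arrows. -/
def green : Node → List Node
  | K4 => [W10201]
  | SG => [W01110, W01102]
  | DG => [W00300, W01110, W10201, W01102, W20102]
  | WG => [F11]
  | W00300 => [F30, F11]
  | W01110 => [F11]
  | W10201 => [F30, F11]
  | W20102 => [F30]
  | _ => []

/-- The targets of the purple arrows. -/
def purple : Node → List Node
  | W20102 => [W01102]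
  | W01102 => [W01110]
  | F30 => [F11]
  | _ => []

/-- The nodes that a node covers. -/
def covered : Node → List Node
  | K4 => [K4, W10201, F30, F11]
  | SG => [SG, W01110, W01102, F11]
  | DG => [DG, W00300, W01110, W10201, W01102, W20102, F30, F11]
  | WG => [WG, F11]
  | LC => [LC]
  | W00300 => [W00300, F30, F11]
  | W01110 => [W01110, F11]
  | W10201 => [W10201, F30, F11]
  | W01102 => [W01102]
  | W20102 => [W20102, F30]
  | F30 => [F30]
  | F11 => [F11]

/-- The nodes that a node is stronger than. -/
def weaker : Node → List Node
  | W01102 => [W01102, W01110, F11]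
  | W20102 => [W20102, W01102, W01110, F30, F11]
  | F30 => [F30, F11]
  | a => covered a

theorem green_iff (a b : Node) : Green a b ↔ b ∈ a.green := by
  constructor
  · rintro ⟨⟩ <;> decide
  · revert b
    cases a <;> simp only [green, List.mem_cons, List.not_mem_nil, or_false, forall_eq_or_imp,
      forall_eq, false_imp_iff, implies_true] <;> repeat' constructor

theorem purple_iff (a b : Node) : Purple a b ↔ b ∈ a.purple := by
  constructor
  · rintro ⟨⟩ <;> decide
  · revert b
    cases a <;> simp only [purple, List.mem_cons, List.not_mem_nil, or_false,
      forall_eq, false_imp_iff, implies_true] <;> constructor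

/-- The hypothesis `hle` suffices because in both diagrams every relation is realised by a path of
at most two arrows. -/
theorem reflTransGen_iff {r : Node → Node → Prop} {l le : Node → List Node}
    (hr : ∀ a b, r a b ↔ b ∈ l a) (hrefl : ∀ a, a ∈ le a)
    (hstep : ∀ a b c, b ∈ le a → c ∈ l b → c ∈ le a)
    (hle : ∀ a b, b ∈ le a → b = a ∨ b ∈ l a ∨ ∃ c ∈ l a, b ∈ l c) (a b : Node) :
    Relation.ReflTransGen r a b ↔ b ∈ le a := by
  constructor
  · intro h
    induction h with
    | refl => exact hrefl a
    | tail _ h ih => exact hstep _ _ _ ih ((hr _ _).1 h)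
  · intro h
    rcases hle a b h with rfl | h | ⟨c, hc, h⟩
    · exact .refl
    · exact .single ((hr _ _).2 h)
    · exact (Relation.ReflTransGen.single ((hr _ _).2 hc)).tail ((hr _ _).2 h)

theorem reflTransGen_green_iff (a b : Node) :
    Relation.ReflTransGen Green a b ↔ b ∈ a.covered :=
  reflTransGen_iff green_iff (by decide +kernel) (by decide +kernel) (by decide +kernel) a b

theorem reflTransGen_green_or_purple_iff (a b : Node) :
    Relation.ReflTransGen (fun c d => Green c d ∨ Purple c d) a b ↔ b ∈ a.weaker :=
  reflTransGen_iff (l := fun a => a.green ++ a.purple)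
    (fun a b => by rw [green_iff, purple_iff, List.mem_append])
    (by decide +kernel) (by decide +kernel) (by decide +kernel) a b

theorem covers_of_green {a b : Node} (h : Green a b) : a.graph.Covers b.graph := by
  cases h
  · exact K4_covers_W10201
  · exact SG_covers_W01110
  · exact SG_covers_W01102
  · exact DG_covers_W00300
  · exact DG_covers_W01110
  · exact DG_covers_W10201
  · exact DG_covers_W01102
  · exact DG_covers_W20102
  · exact WG_covers_F11
  · exact W00300_covers_F30
  · exact W00300_covers_F11
  · exact W01110_covers_F11
  · exact W10201_covers_F30
  · exact W10201_covers_F11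
  · exact W20102_covers_F30

theorem stronger_of_purple {a b : Node} (h : Purple a b) : a.graph.Stronger b.graph := by
  cases h
  · exact W20102_stronger_W01102
  · exact W01102_stronger_W01110
  · exact F30_stronger_F11

theorem covers_of_mem {a b : Node} (h : b ∈ a.covered) : a.graph.Covers b.graph := by
  rw [← reflTransGen_green_iff] at h
  induction h with
  | refl => exact Covers.refl a.graph_connected
  | tail _ h ih => exact ih.trans (covers_of_green h)

theorem stronger_of_mem {a b : Node} (h : b ∈ a.weaker) : a.graph.Stronger b.graph := by
  rw [← reflTransGen_green_or_purple_iff] at h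
  induction h with
  | refl => exact (Covers.refl a.graph_connected).stronger
  | tail _ h ih =>
    exact ih.trans (h.elim (fun h => (covers_of_green h).stronger) stronger_of_purple)

theorem stronger_iff (a b : Node) : a.graph.Stronger b.graph ↔ b ∈ a.weaker := by
  refine ⟨fun h => ?_, stronger_of_mem⟩
  -- These are the extremal failures: a wrong relation from `a` to `b` would extend to one from the
  -- stronger `c.1` to the weaker `c.2`.
  have key : ∀ a b : Node, b ∉ a.weaker → ∃ c ∈ [(LC, F11), (WG, W01110), (WG, LC), (WG, F30),
      (SG, WG), (SG, LC), (SG, F30), (K4, W00300), (K4, W01110), (K4, WG), (K4, LC), (DG, K4),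
      (DG, SG), (DG, WG), (DG, LC), (W00300, W01110), (W00300, W10201), (W01110, W01102),
      (W20102, W00300), (W20102, W10201)], a ∈ weaker c.1 ∧ c.2 ∈ weaker b := by decide +kernel
  by_contra hb
  obtain ⟨c, hc, h1, h2⟩ := key a b hb
  have h3 := ((stronger_of_mem h1).trans h).trans (stronger_of_mem h2)
  clear h1 h2
  simp only [List.mem_cons, List.not_mem_nil, or_false] at hc
  rcases hc with rfl | rfl | rfl | rfl | rfl | rfl | rfl | rfl | rfl | rfl | rfl | rfl | rfl |
    rfl | rfl | rfl | rfl | rfl | rfl | rfl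
  · exact LC_not_stronger_F11 h3
  · exact WG_not_stronger_W01110 h3
  · exact WG_not_stronger_LC h3
  · exact WG_not_stronger_F30 h3
  · exact SG_not_stronger_WG h3
  · exact SG_not_stronger_LC h3
  · exact SG_not_stronger_F30 h3
  · exact K4_not_stronger_W00300 h3
  · exact K4_not_stronger_W01110 h3
  · exact K4_not_stronger_WG h3
  · exact K4_not_stronger_LC h3
  · exact DG_not_stronger_K4 h3
  · exact DG_not_stronger_SG h3
  · exact DG_not_stronger_WG h3
  · exact DG_not_stronger_LC h3
  · exact W00300_not_stronger_W01110 h3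
  · exact W00300_not_stronger_W10201 h3
  · exact W01110_not_stronger_W01102 h3
  · exact W20102_not_stronger_W00300 h3
  · exact W20102_not_stronger_W10201 h3

theorem covers_iff (a b : Node) : a.graph.Covers b.graph ↔ b ∈ a.covered := by
  refine ⟨fun h => ?_, covers_of_mem⟩
  -- Covering implies ▷, so only pairs in `weaker` but not in `covered` remain; these four are
  -- extremal among them.
  have key : ∀ a b : Node, b ∈ a.weaker → b ∉ a.covered → ∃ c ∈ [(W20102, F11),
      (W20102, W01102), (W01102, F11), (F30, F11)], a ∈ covered c.1 ∧ c.2 ∈ covered b := by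
    decide +kernel
  by_contra hb
  obtain ⟨c, hc, h1, h2⟩ := key a b ((stronger_iff a b).1 h.stronger) hb
  have h3 := ((covers_of_mem h1).trans h).trans (covers_of_mem h2)
  have hl : ∀ c ∈ [(W20102, F11), (W20102, W01102), (W01102, F11), (F30, F11)],
      LacksLoop (graph c.1) (graph c.2) := by decide +kernel
  exact (hl c hc).not_covers h3

/-- Purple arrows start at nodes with semi-edges. What they add below a node without semi-edges is
covered by it anyway, as `W01110` is by `SG`. -/
theorem mem_covered_of_mem_weaker {a b : Node} (ha : a.graph.SemiEdgeFree) (h : b ∈ a.weaker) :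
    b ∈ a.covered := by
  have key : ∀ a b : Node, (∀ e, ¬ a.graph.IsSemi e) → b ∈ a.weaker → b ∈ a.covered := by
    decide +kernel
  exact key a b ha h

theorem isPartialOrder_covers :
    IsPartialOrder Node (fun a b => a.graph.Covers b.graph) where
  refl a := Covers.refl a.graph_connected
  trans _ _ _ := Covers.trans
  antisymm a b := by
    simp only [covers_iff]
    revert a b
    decide +kernel

theorem isPartialOrder_stronger :
    IsPartialOrder Node (fun a b => a.graph.Stronger b.graph) where
  refl a := (Covers.refl a.graph_connected).stronger
  trans _ _ _ := Stronger.trans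
  antisymm a b := by
    simp only [stronger_iff]
    revert a b
    decide +kernel

theorem green_iff_hasse (a b : Node) : Green a b ↔
    a ≠ b ∧ a.graph.Covers b.graph ∧
      ∀ c : Node, a.graph.Covers c.graph → c.graph.Covers b.graph → c = a ∨ c = b := by
  simp only [covers_iff, green_iff]
  revert a b
  decide +kernel

theorem purple_iff_hasse (a b : Node) : Purple a b ↔
    ¬ a.graph.Covers b.graph ∧ a.graph.Stronger b.graph ∧
      ∀ c : Node, a.graph.Stronger c.graph → c.graph.Stronger b.graph → c = a ∨ c = b := by
  simp only [covers_iff, stronger_iff, purple_iff]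
  revert a b
  decide +kernel

end Node

/-! ### Classification -/

section
variable {G H : SGraph} {X Y : Type} [DecidableEq X] [DecidableEq Y]

/-- The number of edges (semi-edges if `b`, otherwise not) with ends `z`, in the labelling `φ` of
the vertices. -/
def count (φ : G.V ≃ X) (z : Sym2 X) (b : Bool) : ℕ :=
  Fintype.card {e // ((G.ends e).map φ, G.isSemi e) = (z, b)}

/-- Classes of edges with the same ends and kind have equal sizes in both graphs, so bijections
between the classes glue to one of the edge sets. -/
theorem nonempty_iso_of_count (φ : G.V ≃ X) (ψ : H.V ≃ X)
    (h : ∀ z b, count φ z b = count ψ z b) : Nonempty (G.Iso H) := by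
  let E : ∀ c : Sym2 X × Bool, {e // ((G.ends e).map φ, G.isSemi e) = c} ≃
      {e // ((H.ends e).map ψ, H.isSemi e) = c} :=
    fun c => Fintype.equivOfCardEq (h c.1 c.2)
  let F : G.E ≃ H.E := Equiv.ofFiberEquiv E
  have hF : ∀ e, ((H.ends (F e)).map ψ, H.isSemi (F e)) = ((G.ends e).map φ, G.isSemi e) :=
    Equiv.ofFiberEquiv_map E
  refine ⟨⟨φ.trans ψ.symm, F, fun e => ?_, fun e => (Prod.ext_iff.1 (hF e)).2⟩⟩
  apply Sym2.map.injective ψ.injective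
  refine (Prod.ext_iff.1 (hF e)).1.trans ?_
  rw [Sym2.map_map]
  ext v
  simp

theorem count_trans (φ : G.V ≃ X) (π : X ≃ Y) (z : Sym2 X) (b : Bool) :
    count (φ.trans π) (z.map π) b = count φ z b := by
  refine Fintype.card_congr (Equiv.subtypeEquivRight fun e => ?_)
  rw [Prod.mk.injEq, Prod.mk.injEq, Equiv.coe_trans, ← Sym2.map_map,
    (Sym2.map.injective π.injective).eq_iff]

theorem count_pos {φ : G.V ≃ X} {z : Sym2 X} {b : Bool} (e : G.E)
    (h : (G.ends e).map φ = z) (hb : G.isSemi e = b) : 0 < count φ z b :=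
  Fintype.card_pos_iff.2 ⟨⟨e, by rw [h, hb]⟩⟩

theorem count_eq_zero {φ : G.V ≃ X} {z : Sym2 X} {b : Bool}
    (h : ∀ e, (G.ends e).map φ = z → G.isSemi e ≠ b) : count φ z b = 0 :=
  Fintype.card_eq_zero_iff.2 ⟨fun e => h e.1 (Prod.ext_iff.1 e.2).1 (Prod.ext_iff.1 e.2).2⟩

theorem count_semi_eq_zero (φ : G.V ≃ X) {x y : X} (h : x ≠ y) : count φ s(x, y) true = 0 := by
  refine count_eq_zero fun e he hs => ?_
  have := G.isDiag_of_isSemi e hs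
  rw [← Sym2.isDiag_map φ.injective, he] at this
  exact h this

/-- Both sides are sums over the edges. A normal edge or loop at `x` contributes only at the `y`
that labels its other end. -/
theorem degree_eq_count [Fintype X] (φ : G.V ≃ X) (x : X) :
    G.degree (φ.symm x) =
      ∑ y, count φ s(x, y) false * (if x = y then 2 else 1) + count φ s(x, x) true := by
  have hc : ∀ z b, count φ z b =
      ∑ e, if ((G.ends e).map φ, G.isSemi e) = (z, b) then 1 else 0 := by
    intro z b
    rw [count, Fintype.card_subtype, Finset.card_filter]
  simp only [hc, Finset.sum_mul]
  rw [Finset.sum_comm, ← Finset.sum_add_distrib]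
  refine Finset.sum_congr rfl fun e _ => ?_
  by_cases hs : G.isSemi e = true
  · rw [mult_of_isSemi hs]
    simp only [hs, Prod.mk.injEq, Bool.true_eq_false, and_false, if_false, zero_mul,
      Finset.sum_const_zero, zero_add, and_true]
    refine if_congr ?_ rfl rfl
    rw [← (Sym2.map.injective φ.injective).eq_iff]
    simp
  · obtain ⟨a, b, hab⟩ : ∃ a b, G.ends e = s(a, b) := by
      induction G.ends e with | _ a b => exact ⟨a, b, rfl⟩
    rw [mult_of_ends hs hab]
    simp only [Bool.not_eq_true] at hs
    simp only [hs, hab, Sym2.map_mk, Prod.mk.injEq, Bool.false_eq_true, and_false, if_false,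
      add_zero, and_true, Sym2.eq_iff, Equiv.eq_symm_apply]
    by_cases h1 : φ a = x
    · by_cases h2 : φ b = x
      · rw [Finset.sum_eq_single x (fun y _ hy => by simp [h1, h2, Ne.symm hy]) (by simp)]
        simp [h1, h2]
      · rw [Finset.sum_eq_single (φ b) (fun y _ hy => by simp [h1, h2, Ne.symm hy]) (by simp)]
        simp [h1, h2, Ne.symm h2]
    · by_cases h2 : φ b = x
      · rw [Finset.sum_eq_single (φ a) (fun y _ hy => by simp [h1, h2, Ne.symm hy]) (by simp)]
        simp [h1, h2, Ne.symm h1]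
      · simp [h1, h2]

theorem Connected.exists_crossing (hG : G.Connected) (S : G.V → Prop) {u v : G.V} (hu : S u)
    (hv : ¬ S v) : ∃ e a b, G.ends e = s(a, b) ∧ S a ∧ ¬ S b := by
  have h := hG.preconnected u v
  rw [SimpleGraph.reachable_iff_reflTransGen] at h
  by_contra! hn
  refine hv ?_
  clear hv
  induction h with
  | refl => exact hu
  | tail _ h ih =>
    obtain ⟨⟨f, hf⟩, -⟩ := (SimpleGraph.fromEdgeSet_adj _).1 h
    exact hn f _ _ hf ih

theorem Connected.exists_count_pos (hG : G.Connected) (φ : G.V ≃ X) (S : X → Prop) {x y : X}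
    (hx : S x) (hy : ¬ S y) : ∃ a b, S a ∧ ¬ S b ∧ 0 < count φ s(a, b) false := by
  obtain ⟨e, a, b, he, ha, hb⟩ := hG.exists_crossing (fun v => S (φ v)) (u := φ.symm x)
    (v := φ.symm y) (by simpa using hx) (by simpa using hy)
  refine ⟨φ a, φ b, ha, hb, count_pos e (by rw [he]; rfl) ?_⟩
  rw [Bool.eq_false_iff]
  intro hs
  have := G.isDiag_of_isSemi e hs
  rw [he] at this
  have : a = b := this
  exact hb (this ▸ ha)

end

theorem forall_sym2_fin_one {p : Sym2 (Fin 1) → Prop} (h : p s(0, 0)) (z) : p z := by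
  induction z with | _ a b
  rwa [Subsingleton.elim a 0, Subsingleton.elim b 0]

theorem forall_sym2_fin_two {p : Sym2 (Fin 2) → Prop} (h₀ : p s(0, 0)) (h₁ : p s(0, 1))
    (h₂ : p s(1, 1)) (z) : p z := by
  induction z with | _ a b
  fin_cases a <;> fin_cases b
  exacts [h₀, h₁, Sym2.eq_swap (a := (1 : Fin 2)) (b := 0) ▸ h₁, h₂]

theorem exists_iso_of_card_eq_one {G : SGraph} (hd : G.IsCubic) (hV : Fintype.card G.V = 1) :
    ∃ a : Node, Nonempty (G.Iso a.graph) := by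
  let φ : G.V ≃ Fin 1 := Fintype.equivFinOfCardEq hV
  have h0 := degree_eq_count φ 0
  rw [hd] at h0
  simp only [Finset.univ_unique, Fin.default_eq_zero, Finset.sum_singleton, if_true] at h0
  obtain ⟨h1, h2⟩ | ⟨h1, h2⟩ :
      (count φ s(0, 0) false = 0 ∧ count φ s(0, 0) true = 3) ∨
      (count φ s(0, 0) false = 1 ∧ count φ s(0, 0) true = 1) := by omega
  · refine ⟨.F30, nonempty_iso_of_count φ (Equiv.refl (Fin 1) : Node.F30.graph.V ≃ Fin 1) ?_⟩
    refine forall_sym2_fin_one fun b => ?_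
    cases b
    · rw [h1]; decide +kernel
    · rw [h2]; decide +kernel
  · refine ⟨.F11, nonempty_iso_of_count φ (Equiv.refl (Fin 1) : Node.F11.graph.V ≃ Fin 1) ?_⟩
    refine forall_sym2_fin_one fun b => ?_
    cases b
    · rw [h1]; decide +kernel
    · rw [h2]; decide +kernel

/-- The sixth solution is the fourth with the two vertices exchanged. -/
theorem two_vertex_solutions {k m l p q : ℕ} (h₁ : 3 = m * 2 + l + k) (h₂ : 3 = l + p * 2 + q)
    (h₃ : 0 < l) : (k, m, l, p, q) ∈ [(0, 0, 3, 0, 0), (0, 1, 1, 1, 0), (1, 0, 2, 0, 1),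
      (0, 1, 1, 0, 2), (2, 0, 1, 0, 2), (2, 0, 1, 1, 0)] := by
  obtain rfl : k = 3 - m * 2 - l := by omega
  obtain rfl : q = 3 - l - p * 2 := by omega
  have hm : m < 2 := by omega
  have hp : p < 2 := by omega
  have hl : l < 4 := by omega
  interval_cases m <;> interval_cases p <;> interval_cases l <;>
    first | (exfalso; omega) | decide

theorem exists_iso_of_card_eq_two {G : SGraph} (hG : G.Connected) (hd : G.IsCubic)
    (hV : Fintype.card G.V = 2) : ∃ a : Node, Nonempty (G.Iso a.graph) := by
  let φ : G.V ≃ Fin 2 := Fintype.equivFinOfCardEq hV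
  have key : ∀ (ψ : G.V ≃ Fin 2) (a : Node) (χ : a.graph.V ≃ Fin 2),
      (count ψ s(0, 0) true = count χ s(0, 0) true ∧
        count ψ s(0, 0) false = count χ s(0, 0) false ∧
        count ψ s(0, 1) false = count χ s(0, 1) false ∧
        count ψ s(1, 1) false = count χ s(1, 1) false ∧
        count ψ s(1, 1) true = count χ s(1, 1) true) → ∃ a : Node, Nonempty (G.Iso a.graph) := by
    rintro ψ a χ ⟨h1, h2, h3, h4, h5⟩
    refine ⟨a, nonempty_iso_of_count ψ χ (forall_sym2_fin_two ?_ ?_ ?_)⟩ <;> intro b <;> cases b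
    · exact h2
    · exact h1
    · exact h3
    · rw [count_semi_eq_zero _ (by decide), count_semi_eq_zero _ (by decide)]
    · exact h4
    · exact h5
  have hswap : ∀ x y b, count (φ.trans (Equiv.swap 0 1)) s(x, y) b =
      count φ s(Equiv.swap 0 1 x, Equiv.swap 0 1 y) b := by
    intro x y b
    rw [← count_trans φ (Equiv.swap 0 1)]
    simp
  have h0 := degree_eq_count φ 0
  have h1 := degree_eq_count φ 1
  rw [hd] at h0 h1
  simp only [Fin.sum_univ_two, if_true, Fin.isValue, zero_ne_one, one_ne_zero, if_false,
    mul_one, Sym2.eq_swap (a := (1 : Fin 2)) (b := 0)] at h0 h1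
  have hl : 0 < count φ s(0, 1) false := by
    obtain ⟨a, b, ha, hb, h⟩ := hG.exists_count_pos φ (· = 0) (x := 0) (y := 1) rfl (by decide)
    obtain rfl : b = 1 := by omega
    rwa [ha] at h
  have h := two_vertex_solutions h0 h1 hl
  simp only [List.mem_cons, Prod.mk.injEq, List.not_mem_nil, or_false] at h
  rcases h with ⟨h1, h2, h3, h4, h5⟩ | ⟨h1, h2, h3, h4, h5⟩ | ⟨h1, h2, h3, h4, h5⟩ |
    ⟨h1, h2, h3, h4, h5⟩ | ⟨h1, h2, h3, h4, h5⟩ | ⟨h1, h2, h3, h4, h5⟩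
  · refine key φ .W00300 (Equiv.refl (Fin 2)) ?_
    rw [h1, h2, h3, h4, h5]; decide +kernel
  · refine key φ .W01110 (Equiv.refl (Fin 2)) ?_
    rw [h1, h2, h3, h4, h5]; decide +kernel
  · refine key φ .W10201 (Equiv.refl (Fin 2)) ?_
    rw [h1, h2, h3, h4, h5]; decide +kernel
  · refine key φ .W01102 (Equiv.refl (Fin 2)) ?_
    rw [h1, h2, h3, h4, h5]; decide +kernel
  · refine key φ .W20102 (Equiv.refl (Fin 2)) ?_
    rw [h1, h2, h3, h4, h5]; decide +kernel
  · refine key (φ.trans (Equiv.swap 0 1)) .W01102 (Equiv.refl (Fin 2)) ?_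
    simp only [hswap, Equiv.swap_apply_left, Equiv.swap_apply_right,
      Sym2.eq_swap (a := (1 : Fin 2)) (b := 0)]
    rw [h1, h2, h3, h4, h5]; decide +kernel

/-- The numbers of edges between the vertices of a graph on four vertices without semi-edges. -/
def fourTable : List (Node × (Fin 4 → Fin 4 → ℕ)) :=
  [(.K4, ![![0, 1, 1, 1], ![1, 0, 1, 1], ![1, 1, 0, 1], ![1, 1, 1, 0]]),
    (.SG, ![![1, 1, 0, 0], ![1, 0, 2, 0], ![0, 2, 0, 1], ![0, 0, 1, 1]]),
    (.DG, ![![0, 2, 0, 1], ![2, 0, 1, 0], ![0, 1, 0, 2], ![1, 0, 2, 0]]),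
    (.WG, ![![1, 1, 0, 0], ![1, 0, 1, 1], ![0, 1, 0, 2], ![0, 1, 2, 0]]),
    (.LC, ![![0, 1, 1, 1], ![1, 1, 0, 0], ![1, 0, 1, 0], ![1, 0, 0, 1]])]

theorem fourTable_spec : ∀ c ∈ fourTable, ∃ χ : c.1.graph.V ≃ Fin 4,
    ∀ i j, count χ s(i, j) false = c.2 i j ∧ count χ s(i, j) true = 0 := by
  simp only [fourTable, List.mem_cons, List.not_mem_nil, or_false, forall_eq_or_imp, forall_eq]
  refine ⟨⟨Equiv.refl (Fin 4), ?_⟩, ⟨Equiv.refl (Fin 4), ?_⟩, ⟨Equiv.refl (Fin 4), ?_⟩,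
    ⟨Equiv.refl (Fin 4), ?_⟩, ⟨Equiv.refl (Fin 4), ?_⟩⟩ <;> decide +kernel

/-- The permutations of four points. -/
def fourPerms : List (Fin 4 → Fin 4) :=
  (List.finRange 4).flatMap fun a => (List.finRange 4).flatMap fun b =>
    (List.finRange 4).flatMap fun c => (List.finRange 4).filterMap fun d =>
      if [a, b, c, d].Nodup then some ![a, b, c, d] else none

theorem injective_of_mem_fourPerms : ∀ f ∈ fourPerms, Function.Injective f := by decide +kernel

/-- These numbers of loops and edges are those of a graph in `fourTable`, up to relabelling. -/
def InFourTable (a₀ x y z a₁ u v a₂ w a₃ : ℕ) : Prop :=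
  ∃ c ∈ fourTable, ∃ f ∈ fourPerms,
    a₀ = c.2 (f 0) (f 0) ∧ x = c.2 (f 0) (f 1) ∧ y = c.2 (f 0) (f 2) ∧ z = c.2 (f 0) (f 3) ∧
    a₁ = c.2 (f 1) (f 1) ∧ u = c.2 (f 1) (f 2) ∧ v = c.2 (f 1) (f 3) ∧
    a₂ = c.2 (f 2) (f 2) ∧ w = c.2 (f 2) (f 3) ∧ a₃ = c.2 (f 3) (f 3)

instance (a₀ x y z a₁ u v a₂ w a₃ : ℕ) : Decidable (InFourTable a₀ x y z a₁ u v a₂ w a₃) := by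
  unfold InFourTable; infer_instance

/-- Without semi-edges a cubic component has even order, so connectedness only has to exclude the
three splittings into two pairs. Each degree equation precedes the next variables to prune the
enumeration. -/
theorem inFourTable_of_degree : ∀ (a₀ : Fin 2) (x y z : Fin 4), a₀.1 * 2 + x + y + z = 3 →
    ∀ (a₁ : Fin 2) (u v : Fin 4), x.1 + a₁ * 2 + u + v = 3 →
    ∀ (a₂ : Fin 2) (w : Fin 4), y.1 + u + a₂ * 2 + w = 3 → ∀ a₃ : Fin 2,
    (z.1 + v + w + a₃ * 2 = 3 ∧
      0 < y.1 + z + u + v ∧ 0 < x.1 + z + u + w ∧ 0 < x.1 + y + v + w) →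
    InFourTable a₀ x y z a₁ u v a₂ w a₃ := by
  decide +kernel

theorem exists_mem_fourTable {q : Fin 4 → Fin 4 → ℕ} (hsymm : ∀ i j, q i j = q j i)
    (hdeg : ∀ x, 3 = ∑ y, q x y * (if x = y then 2 else 1))
    (hcross : ∀ i : Fin 4, i ≠ 0 → ∃ a b, (a = 0 ∨ a = i) ∧ ¬ (b = 0 ∨ b = i) ∧ 0 < q a b) :
    ∃ c ∈ fourTable, ∃ f ∈ fourPerms, ∀ i j, q i j = c.2 (f i) (f j) := by
  have s10 := hsymm 1 0
  have s20 := hsymm 2 0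
  have s21 := hsymm 2 1
  have s30 := hsymm 3 0
  have s31 := hsymm 3 1
  have s32 := hsymm 3 2
  have c1 : 0 < q 0 2 + q 0 3 + q 1 2 + q 1 3 := by
    obtain ⟨a, b, ha | ha, hb, h⟩ := hcross 1 (by decide) <;> subst ha <;>
      fin_cases b <;> simp at hb h <;> omega
  have c2 : 0 < q 0 1 + q 0 3 + q 1 2 + q 2 3 := by
    obtain ⟨a, b, ha | ha, hb, h⟩ := hcross 2 (by decide) <;> subst ha <;>
      fin_cases b <;> simp at hb h <;> omega
  have c3 : 0 < q 0 1 + q 0 2 + q 1 3 + q 2 3 := by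
    obtain ⟨a, b, ha | ha, hb, h⟩ := hcross 3 (by decide) <;> subst ha <;>
      fin_cases b <;> simp at hb h <;> omega
  have h0 := hdeg 0
  have h1 := hdeg 1
  have h2 := hdeg 2
  have h3 := hdeg 3
  simp only [Fin.sum_univ_four, Fin.reduceEq, if_true, if_false, mul_one] at h0 h1 h2 h3
  rw [s10] at h1
  rw [s20, s21] at h2
  rw [s30, s31, s32] at h3
  clear hdeg hcross
  obtain ⟨c, hc, f, hf, e1, e2, e3, e4, e5, e6, e7, e8, e9, e10⟩ :=
    inFourTable_of_degree ⟨q 0 0, by omega⟩ ⟨q 0 1, by omega⟩ ⟨q 0 2, by omega⟩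
      ⟨q 0 3, by omega⟩ h0.symm ⟨q 1 1, by omega⟩ ⟨q 1 2, by omega⟩ ⟨q 1 3, by omega⟩
      h1.symm ⟨q 2 2, by omega⟩ ⟨q 2 3, by omega⟩ h2.symm ⟨q 3 3, by omega⟩
      ⟨h3.symm, c1, c2, c3⟩
  have hcs : ∀ c ∈ fourTable, ∀ i j, c.2 i j = c.2 j i := by decide +kernel
  refine ⟨c, hc, f, hf, ?_⟩
  have hdiag : ∀ i, q i i = c.2 (f i) (f i) := by
    intro i
    fin_cases i <;> assumption
  have hlt : ∀ i j : Fin 4, i < j → q i j = c.2 (f i) (f j) := by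
    intro i j hij
    fin_cases i <;> fin_cases j <;> first | assumption | exact absurd hij (by decide)
  intro i j
  rcases lt_trichotomy i j with h | rfl | h
  · exact hlt i j h
  · exact hdiag i
  · rw [hsymm, hcs c hc, hlt j i h]

theorem exists_iso_of_card_eq_four {G : SGraph} (hG : G.Connected) (hd : G.IsCubic)
    (hs : G.SemiEdgeFree) (hV : Fintype.card G.V = 4) : ∃ a : Node, Nonempty (G.Iso a.graph) := by
  let φ : G.V ≃ Fin 4 := Fintype.equivFinOfCardEq hV
  have ht : ∀ z, count φ z true = 0 := fun z => count_eq_zero fun e _ => hs e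
  obtain ⟨c, hc, f, hf, hq⟩ := exists_mem_fourTable (q := fun i j => count φ s(i, j) false)
    (fun i j => by rw [Sym2.eq_swap])
    (fun x => by rw [← hd (φ.symm x), degree_eq_count φ x, ht, add_zero])
    (fun i hi => by
      obtain ⟨j, hj⟩ : ∃ j : Fin 4, ¬ (j = 0 ∨ j = i) := by revert i; decide
      exact hG.exists_count_pos φ (fun a => a = 0 ∨ a = i) (Or.inl rfl) hj)
  obtain ⟨χ, hχ⟩ := fourTable_spec c hc
  let π : Equiv.Perm (Fin 4) := Equiv.ofBijective f
    (Finite.injective_iff_bijective.1 (injective_of_mem_fourPerms f hf))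
  refine ⟨c.1, nonempty_iso_of_count (φ.trans π) χ fun z b => ?_⟩
  obtain ⟨z, rfl⟩ : ∃ z', z'.map π = z := ⟨z.map π.symm, by simp [Sym2.map_map]⟩
  rw [count_trans]
  induction z with | _ i j
  cases b
  · exact (hq i j).trans (hχ _ _).1.symm
  · rw [ht, Sym2.map_mk, (hχ _ _).2]

theorem IsSmallCubic.exists_iso {G : SGraph} (hG : G.IsSmallCubic) :
    ∃ a : Node, Nonempty (G.Iso a.graph) := by
  obtain ⟨hc, hd, h | h | ⟨h, hs⟩⟩ := hG
  · exact exists_iso_of_card_eq_one hd h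
  · exact exists_iso_of_card_eq_two hc hd h
  · exact exists_iso_of_card_eq_four hc hd hs h

/-- Two nodes isomorphic to `G` cover each other, so antisymmetry identifies them. -/
theorem IsSmallCubic.existsUnique_iso {G : SGraph} (hG : G.IsSmallCubic) :
    ∃! a : Node, Nonempty (G.Iso a.graph) := by
  obtain ⟨a, ⟨φ⟩⟩ := hG.exists_iso
  refine ⟨a, ⟨φ⟩, ?_⟩
  rintro b ⟨ψ⟩
  exact Node.isPartialOrder_covers.antisymm _ _
    ((ψ.symm.covers hG.1).trans (φ.covers a.graph_connected))
    ((φ.symm.covers hG.1).trans (ψ.covers b.graph_connected))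

/-! ### Being stronger than an arbitrary graph -/

theorem SemiEdgeFree.even_of_isCubic {A : SGraph} (hs : A.SemiEdgeFree) (hd : A.IsCubic) :
    Even (Fintype.card A.V) := by
  have h1 : ∑ v, A.degree v = Fintype.card A.V * 3 := by
    simp [Finset.sum_congr rfl fun v _ => hd v]
  have h2 : Even (∑ v, A.degree v) := by
    unfold degree
    rw [Finset.sum_comm]
    refine Finset.even_sum _ fun e _ => ?_
    obtain ⟨a, b, hab⟩ : ∃ a b, A.ends e = s(a, b) := by
      induction A.ends e with | _ a b => exact ⟨a, b, rfl⟩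
    simp only [mult_of_ends (hs e) hab, Finset.sum_add_distrib, Finset.sum_ite_eq,
      Finset.mem_univ, if_true]
    decide
  rw [h1, Nat.even_mul] at h2
  exact h2.resolve_right (by decide)

theorem Iso.semiEdgeFree {G H : SGraph} (φ : G.Iso H) (h : G.SemiEdgeFree) : H.SemiEdgeFree := by
  intro e
  obtain ⟨e, rfl⟩ := φ.onE.surjective e
  unfold IsSemi
  rw [φ.isSemi_onE]
  exact h e

/-- A graph that a semi-edge-free node is stronger than is itself one of the nodes. -/
theorem Node.isSmallCubic_of_stronger {a : Node} (ha : a.graph.SemiEdgeFree) {B : SGraph}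
    (h : a.graph.Stronger B) : B.IsSmallCubic := by
  obtain ⟨T⟩ := Node.exists_volt ha
  -- The lifts have 3|A| and 4|A| vertices, both multiples of |B|; their difference is |A|.
  obtain ⟨hB, ⟨p⟩⟩ := h _ (T.lift_isSimple 3 (by norm_num))
    (T.lift_covers 3 a.graph_connected)
  obtain ⟨-, ⟨q⟩⟩ := h _ (T.lift_isSimple 4 (by norm_num)) (T.lift_covers 4 a.graph_connected)
  obtain ⟨-, ⟨r⟩⟩ := T.lift_covers 3 a.graph_connected
  have hd : B.IsCubic := by
    intro x
    obtain ⟨v, rfl⟩ := p.surjective_onV x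
    rw [p.degree_onV, ← r.degree_onV, a.graph_isCubic]
  obtain ⟨x⟩ : Nonempty B.V := hB.nonempty
  have h1 := p.toWeak.card_eq hB x
  have h2 := q.toWeak.card_eq hB x
  rw [T.card_lift] at h1 h2
  have hdvd : Fintype.card B.V ∣ Fintype.card a.graph.V := by
    have := Nat.dvd_sub (Dvd.intro _ h2.symm) (Dvd.intro _ h1.symm)
    rwa [← Nat.mul_sub, show 4 - 3 = 1 from rfl, mul_one] at this
  have h4 : Fintype.card a.graph.V ∣ 4 := by
    obtain h | h | h := a.graph_isSmallCubic.2.2 <;> simp [h]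
  have hle := Nat.le_of_dvd (by norm_num) (hdvd.trans h4)
  have hdvd4 := hdvd.trans h4
  refine ⟨hB, hd, ?_⟩
  have hcases : ∀ n ≤ 4, n ∣ 4 → n = 1 ∨ n = 2 ∨ n = 4 := by decide
  rcases hcases _ hle hdvd4 with h | h | h
  · exact Or.inl h
  · exact Or.inr (Or.inl h)
  · refine Or.inr (Or.inr ⟨h, fun f hf => ?_⟩)
    -- With |A| = |B| = 4 the 3-fold lift has fibres of size 3 over `B`, while a semi-edge needs an
    -- even fibre.
    have hA : Fintype.card a.graph.V = 4 :=
      Nat.le_antisymm (Nat.le_of_dvd (by norm_num) h4)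
        (h ▸ Nat.le_of_dvd (Fintype.card_pos_iff.2 a.graph_connected.nonempty) hdvd)
    obtain ⟨y, hy⟩ : ∃ y, y ∈ B.ends f := by
      induction B.ends f with | _ a b => exact ⟨a, by simp⟩
    have h5 := p.toWeak.card_eq hB y
    have h6 := p.toWeak.even_card_fiber (T.lift_semiEdgeFree 3) hf hy
    rw [T.card_lift, hA, h] at h5
    obtain ⟨k, hk⟩ := h6
    omega

theorem stronger_iff_covers {A : SGraph} (hA : A.Connected) (hd : A.IsCubic)
    (hs : A.SemiEdgeFree) (hV : Fintype.card A.V ≤ 4) (B : SGraph) :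
    A.Stronger B ↔ A.Covers B := by
  refine ⟨fun h => ?_, Covers.stronger⟩
  have hsmall : A.IsSmallCubic := by
    refine ⟨hA, hd, ?_⟩
    -- By the handshake lemma orders 1 and 3 do not occur.
    have := hs.even_of_isCubic hd
    have := Fintype.card_pos_iff.2 hA.nonempty
    have hcases : ∀ n ≤ 4, Even n → 0 < n → n = 2 ∨ n = 4 := by decide
    rcases hcases _ hV ‹_› this with h | h
    · exact Or.inr (Or.inl h)
    · exact Or.inr (Or.inr ⟨h, hs⟩)
  obtain ⟨a, ⟨φ⟩⟩ := hsmall.exists_iso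
  have ha := φ.semiEdgeFree hs
  have haB : a.graph.Stronger B := (φ.symm.covers hA).stronger.trans h
  have hB := Node.isSmallCubic_of_stronger ha haB
  obtain ⟨b, ⟨ψ⟩⟩ := hB.exists_iso
  have hab : a.graph.Stronger b.graph := haB.trans (ψ.covers b.graph_connected).stronger
  have hab' := (Node.covers_iff a b).2
    (Node.mem_covered_of_mem_weaker ha ((Node.stronger_iff a b).1 hab))
  exact ((φ.covers a.graph_connected).trans hab').trans (ψ.symm.covers hB.1)

end SGraph

theorem mainTheorem4 :
    -- the nodes are exactly the small cubic graphs, each listed once up to isomorphism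
    (∀ a : SGraph.Node, a.graph.IsSmallCubic) ∧
    (∀ G : SGraph, G.IsSmallCubic → ∃! a : SGraph.Node, Nonempty (G.Iso a.graph)) ∧
    -- both relations are partial orders on them
    IsPartialOrder SGraph.Node (fun a b => a.graph.Covers b.graph) ∧
    IsPartialOrder SGraph.Node (fun a b => a.graph.Stronger b.graph) ∧
    -- the complete covering relation, and the green arrows are its Hasse diagram
    (∀ a b : SGraph.Node,
      a.graph.Covers b.graph ↔ Relation.ReflTransGen SGraph.Green a b) ∧
    (∀ a b : SGraph.Node, SGraph.Green a b ↔
      a ≠ b ∧ a.graph.Covers b.graph ∧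
        ∀ c : SGraph.Node, a.graph.Covers c.graph → c.graph.Covers b.graph → c = a ∨ c = b) ∧
    -- the complete relation of being stronger, and the purple arrows are the arrows of its
    -- Hasse diagram that are not covering projections
    (∀ a b : SGraph.Node,
      a.graph.Stronger b.graph ↔
        Relation.ReflTransGen (fun c d => SGraph.Green c d ∨ SGraph.Purple c d) a b) ∧
    (∀ a b : SGraph.Node, SGraph.Purple a b ↔
      ¬ a.graph.Covers b.graph ∧ a.graph.Stronger b.graph ∧
        ∀ c : SGraph.Node,
          a.graph.Stronger c.graph → c.graph.Stronger b.graph → c = a ∨ c = b) ∧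
    -- for connected cubic graphs `A` without semi-edges on at most four vertices, being stronger
    -- than any graph `B` is the same as covering it
    (∀ A : SGraph, A.Connected → A.IsCubic → A.SemiEdgeFree → Fintype.card A.V ≤ 4 →
      ∀ B : SGraph, A.Stronger B ↔ A.Covers B) := by
  refine ⟨SGraph.Node.graph_isSmallCubic, fun _ hG => hG.existsUnique_iso,
    SGraph.Node.isPartialOrder_covers, SGraph.Node.isPartialOrder_stronger, fun a b => ?_,
    SGraph.Node.green_iff_hasse, fun a b => ?_, SGraph.Node.purple_iff_hasse,
    fun A hA hd hs hV B => SGraph.stronger_iff_covers hA hd hs hV B⟩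
  · rw [SGraph.Node.covers_iff, SGraph.Node.reflTransGen_green_iff]
  · rw [SGraph.Node.stronger_iff, SGraph.Node.reflTransGen_green_or_purple_iff]
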